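/- Let $\mathcal G_0$ be the space of right continuous nondecreasing maps $g:[0,1)\to[0,1]$, extended by $g(1)=1$, equipped with the $L^2$-metric $\|g-h\|_{L^2}=\big(\int_0^1|g(t)-h(t)|^2\,dt\big)^{1/2}$. For $\beta>0$ let $\mathbb Q_0=\mathbb Q_0^\beta$ be the Dirichlet process on $\mathcal G_0$, that is, the Borel probability measure such that for all $N$ and all $0=t_0<t_1<\dots<t_N<t_{N+1}=1$ the vector $(g_{t_1},\dots,g_{t_N})$ has under $\mathbb Q_0$ the density $$\frac{\Gamma(\beta)}{\prod_{i=0}^N\Gamma(\beta(t_{i+1}-t_i))}\prod_{i=0}^N(x_{i+1}-x_i)^{\beta(t_{i+1}-t_i)-1}$$ on $\{0=x_0<x_1<\dots<x_N<x_{N+1}=1\}$. Let $\mathfrak Z^1(\mathcal G_0)$ be the set of cylinder functions $u(g)=U\big(\int_0^1\alpha_1(g_s)\,ds,\dots,\int_0^1\alpha_m(g_s)\,ds\big)$ with $m\in\mathbb N$, $U\in C^1(\mathbb R^m)$ and $\alpha_i\in C^1([0,1])$, and for such $u$ put $$\mathbb D u(g)(t)=\sum_{i=1}^m\partial_iU\Big(\int_0^1\vec\alpha(g_s)\,ds\Big)\,\alpha_i'(g_t).$$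 Let $\overline{\mathbb D}$ be the closure of $\mathbb D:\mathfrak Z^1(\mathcal G_0)\to L^2(\mathcal G_0\times[0,1],\mathbb Q_0\otimes\mathrm{Leb})$ as an operator in $L^2(\mathcal G_0,\mathbb Q_0)$: $u\in\mathrm{Dom}(\overline{\mathbb D})$ with $\overline{\mathbb D}u=V$ if there are $u_n\in\mathfrak Z^1(\mathcal G_0)$ with $u_n\to u$ in $L^2(\mathbb Q_0)$ and $\mathbb Du_n\to V$ in $L^2(\mathbb Q_0\otimes\mathrm{Leb})$. Its domain is the domain $\mathrm{Dom}(\mathbb E)$ of the closure of the Dirichlet form $\mathbb E(u,u)=\int_{\mathcal G_0}\|\mathbb Du(g)\|_{L^2}^2\,d\mathbb Q_0(g)$ on $\mathfrak Z^1(\mathcal G_0)$, and its square field operator is $\Gamma(u,v)=\langle\overline{\mathbb D}u,\overline{\mathbb D}v\rangle_{L^2(\mathrm{Leb})}$. **Theorem.** For every $\beta>0$, every continuous function $u:\mathcal G_0\to\mathbb R$ with $u\in\mathrm{Dom}(\mathbb E)$ and $\Gamma(u,u)\le1$ $\mathbb Q_0$-a.e. on $\mathcal G_0$ is 1-Lipschitz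 on $\mathcal G_0$: $$|u(g)-u(h)|\le\|g-h\|_{L^2}\qquad\text{for all }g,h\in\mathcal G_0.$$ -/

import Mathlib

open MeasureTheory Filter Topology Set unitInterval

noncomputable section

/-- The space `𝒢₀` of right continuous nondecreasing maps `[0,1) → [0,1]`, each of them extended to
`[0,1]` by `g 1 = 1`. (Right continuity and monotonicity at the end point `1` are then automatic.) -/
structure G0 where
  toFun : I → I
  mono' : Monotone toFun
  rightCont' : ∀ t, ContinuousWithinAt toFun (Ici t) t
  map_one' : toFun 1 = 1

namespace G0

instance : CoeFun G0 (fun _ => I → I) := ⟨G0.toFun⟩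

theorem memLp (g : G0) : MemLp (fun t : I => (g t : ℝ)) 2 (volume : Measure I) := by
  refine MemLp.of_bound ?_ 1 ?_
  · exact (measurable_subtype_coe.comp g.mono'.measurable).aestronglyMeasurable
  · refine Eventually.of_forall fun t => ?_
    rw [Real.norm_eq_abs, abs_of_nonneg (g t).2.1]
    exact (g t).2.2

/-- The inclusion `𝒢₀ ⊆ L²([0,1], Leb)`. -/
def toL2 (g : G0) : Lp ℝ 2 (volume : Measure I) := g.memLp.toLp _

theorem toL2_injective : Function.Injective toL2 := by
  intro g h hgh
  have hae : ∀ᵐ t : I, (g t : ℝ) = h t := (MemLp.toLp_eq_toLp_iff g.memLp h.memLp).1 hgh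
  have key : ∀ t, g t = h t := by
    intro t
    rcases eq_or_lt_of_le t.2.2 with h1 | h1
    · have : t = 1 := Subtype.ext h1
      rw [this]; exact g.map_one'.trans h.map_one'.symm
    · have hgt : Tendsto g.toFun (𝓝[>] t) (𝓝 (g t)) :=
        (g.rightCont' t).mono_left (nhdsWithin_mono _ Ioi_subset_Ici_self)
      have hht : Tendsto h.toFun (𝓝[>] t) (𝓝 (h t)) :=
        (h.rightCont' t).mono_left (nhdsWithin_mono _ Ioi_subset_Ici_self)
      have hlt : t < (1 : I) := h1
      have hcl : t ∈ closure (Ioi t ∩ {s : I | g s = h s}) := by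
        refine mem_closure_iff_nhds.2 fun O hO => ?_
        obtain ⟨r, hr, hrO⟩ := exists_Ico_subset_of_mem_nhds hO ⟨1, hlt⟩
        have hpos : (volume : Measure I) (Ioo t r) ≠ 0 := by
          rw [unitInterval.volume_Ioo]
          simpa using hr
        obtain ⟨s, hs, hs'⟩ := (frequently_ae_mem_iff.2 hpos).and_eventually hae |>.exists
        exact ⟨s, hrO ⟨hs.1.le, hs.2⟩, hs.1, Subtype.ext hs'⟩
      have hne : (𝓝[Ioi t ∩ {s : I | g s = h s}] t).NeBot := mem_closure_iff_nhdsWithin_neBot.1 hcl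
      have hg' := hgt.mono_left (nhdsWithin_mono t (inter_subset_left (t := {s : I | g s = h s})))
      have hh' := hht.mono_left (nhdsWithin_mono t (inter_subset_left (t := {s : I | g s = h s})))
      refine tendsto_nhds_unique (hg'.congr' ?_) hh'
      filter_upwards [self_mem_nhdsWithin] with s hs using hs.2
  cases g; cases h
  congr
  exact funext key

/-- `𝒢₀` carries the `L²`-metric. -/
instance : MetricSpace G0 := MetricSpace.induced toL2 toL2_injective inferInstance

theorem dist_eq (g h : G0) :
    dist g h = Real.sqrt (∫ t : I, ((g t : ℝ) - h t) ^ 2) := by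
  have h0 : dist g h = ‖toL2 g - toL2 h‖ := dist_eq_norm (toL2 g) (toL2 h)
  rw [h0, toL2, toL2, ← MemLp.toLp_sub, Lp.norm_toLp,
    MemLp.eLpNorm_eq_integral_rpow_norm (by norm_num) (by norm_num) (g.memLp.sub h.memLp),
    ENNReal.toReal_ofReal (by positivity), Real.sqrt_eq_rpow]
  norm_num

/-- Measures on `𝒢₀` are Borel measures. -/
instance : MeasurableSpace G0 := borel G0

instance : BorelSpace G0 := ⟨rfl⟩

end G0

/-- `(0, x₁, …, x_N, 1)`. -/
def padUnit {N : ℕ} (x : Fin N → ℝ) : Fin (N + 2) → ℝ :=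
  Fin.cons 0 (Fin.snoc x 1 : Fin (N + 1) → ℝ)

open Classical in
/-- The density, with `x₀ = t₀ = 0` and `x_{N+1} = t_{N+1} = 1`,
`Γ(β) / ∏ᵢ Γ(β (tᵢ₊₁ - tᵢ)) * ∏ᵢ (xᵢ₊₁ - xᵢ) ^ (β (tᵢ₊₁ - tᵢ) - 1)` on the simplex
`0 < x₁ < ⋯ < x_N < 1`, and `0` off the simplex. -/
def dirichletDensity (β : ℝ) {N : ℕ} (t x : Fin N → ℝ) : ℝ :=
  if StrictMono (padUnit x) then
    Real.Gamma β /
        (∏ i : Fin (N + 1), Real.Gamma (β * (padUnit t i.succ - padUnit t i.castSucc))) *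
      ∏ i : Fin (N + 1), (padUnit x i.succ - padUnit x i.castSucc) ^
        (β * (padUnit t i.succ - padUnit t i.castSucc) - 1)
  else 0

/-- `Q` is the law `ℚ₀^β` of the Dirichlet process on `𝒢₀` with parameter `β`: the probability
measure on `𝒢₀` such that, for all `0 < t₁ < ⋯ < t_N < 1`, the vector `(g t₁, …, g t_N)` has the
Dirichlet density. -/
structure IsDirichletProcess (β : ℝ) (Q : Measure G0) : Prop where
  isProbabilityMeasure : IsProbabilityMeasure Q
  finiteDim : ∀ (N : ℕ) (t : Fin N → I), StrictMono (padUnit fun i => (t i : ℝ)) →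
    ∀ A : Set (Fin N → ℝ), MeasurableSet A →
      Q {g : G0 | (fun i => (g (t i) : ℝ)) ∈ A} =
        ∫⁻ x in A, ENNReal.ofReal (dirichletDensity β (fun i => (t i : ℝ)) x)

/-- The data `(m, U, α)` of a cylinder function `u(g) = U (∫₀¹ α₁(g_s) ds, …, ∫₀¹ α_m(g_s) ds)` in
`ℨ¹(𝒢₀)`, with `U ∈ C¹(ℝᵐ)` and `α₁, …, α_m ∈ C¹([0,1])`. -/
structure ZCylinder where
  m : ℕ
  U : (Fin m → ℝ) → ℝ
  α : Fin m → ℝ → ℝ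
  contDiff_U : ContDiff ℝ 1 U
  contDiffOn_α : ∀ i, ContDiffOn ℝ 1 (α i) (Icc 0 1)

namespace ZCylinder

/-- `∫₀¹ α(g_s) ds ∈ ℝᵐ`. -/
def coords (c : ZCylinder) (g : G0) : Fin c.m → ℝ := fun i => ∫ s : I, c.α i (g s)

/-- The cylinder function itself. -/
def toFun (c : ZCylinder) (g : G0) : ℝ := c.U (c.coords g)

/-- The `L²`-gradient
`𝔻u(g)(t) = ∑ᵢ ∂ᵢU (∫₀¹ α(g_s) ds) αᵢ'(g_t)`, as a function on `𝒢₀ × [0,1]`. -/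
def grad (c : ZCylinder) (p : G0 × I) : ℝ :=
  ∑ i : Fin c.m, fderiv ℝ c.U (c.coords p.1) (Pi.single i 1) *
    derivWithin (c.α i) (Icc 0 1) (p.1 p.2)

end ZCylinder

/-- `(u, V)` lies in the graph of the closure `𝔻̄` of
`𝔻 : ℨ¹(𝒢₀) ⊆ L²(𝒢₀, Q) → L²(𝒢₀ × [0,1], Q ⊗ Leb)`, i.e. `u ∈ Dom(𝔻̄) = Dom(𝔼)` and `𝔻̄ u = V`. -/
def IsClosedGradient (Q : Measure G0) (u : G0 → ℝ) (V : G0 × I → ℝ) : Prop :=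
  MemLp u 2 Q ∧ MemLp V 2 (Q.prod volume) ∧
    ∃ c : ℕ → ZCylinder,
      Tendsto (fun n => eLpNorm (fun g => (c n).toFun g - u g) 2 Q) atTop (𝓝 0) ∧
      Tendsto (fun n => eLpNorm (fun p => (c n).grad p - V p) 2 (Q.prod volume)) atTop (𝓝 0)

/-- The square field operator `Γ(u, v)(g) = ⟨𝔻̄u(g), 𝔻̄v(g)⟩_{L²(Leb)}` in terms of `V = 𝔻̄u` and
`W = 𝔻̄v`. -/
def squareField (V W : G0 × I → ℝ) (g : G0) : ℝ := ∫ t : I, V (g, t) * W (g, t)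

end

/-! The bound on the gradient holds only `Q`-almost everywhere, so it cannot be integrated along one
fixed segment, only along families of paths whose law at each time is absolutely continuous with
respect to `Q`. Such families come from reweighting. For a positive step function `f` put `T_f g (t)
= ∫_{[0,t]} f dg / ∫_{[0,1]} f dg`. The Dirichlet process is a normalized gamma process, and
rescaling independent gamma increments changes their law by an explicit density. Accordingly `T_f`
maps the measure with density `(∫ f dg) ^ (-β)` to a multiple of `Q` (`map_reweight_withDensity`),
and since `f` is bounded above and away from `0`, the law of `T_f` under `Q` is at most a constant
times `Q` (`map_reweight_le`).

With `f_s = 1 - s + s f`, the curve `s ↦ T_{f_s} g` runs monotonically through the straight segment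
from `g` to `T_f g` (`reweight_mix_apply`). The fundamental theorem of calculus holds along it for
cylinder functions (`toFun_sub_toFun`). The bounds on the laws, uniform in `s`, control the error of
replacing `u` and its gradient by those of a cylinder function (`lintegral_excess_le`). In the
limit, `|u (T_f g) - u g| ≤ ‖T_f g - g‖` for `Q`-almost every `g` (`ae_enorm_sub_le`).

The weight `f` is still free. Given `g`, `h` and a grid, ratios of increments define an `f` that
carries the values of `g` on the grid to those of `h`, after a small perturbation that makes both
strictly increasing. The finite dimensional marginals have full support, so some `g'` close to `g`
on the grid satisfies the inequality while `T_f g'` is close to `h` there (`exists_pair`). For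
monotone maps, closeness on ever finer grids is convergence in `L²` (`tendsto_of_gridPoint`), and
the continuity of `u` yields the bound for `g` and `h`. -/

noncomputable section

/-! ### Measurability on `𝒢₀`: the Borel sets are generated by the evaluations. -/

namespace G0

theorem measurable_coe (g : G0) : Measurable fun t : I => (g t : ℝ) :=
  measurable_subtype_coe.comp g.mono'.measurable

theorem integrable_coe (g : G0) : Integrable (fun t : I => (g t : ℝ)) :=
  g.memLp.integrable (by norm_num)

theorem continuous_toL2 : Continuous toL2 := continuous_induced_dom

/-- The integral is the inner product in `L²` with an indicator function. -/
theorem continuous_setIntegral_coe {s : Set I} (hs : MeasurableSet s) :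
    Continuous fun g : G0 => ∫ t in s, (g t : ℝ) := by
  have h : (fun g : G0 => ∫ t in s, (g t : ℝ)) = fun g : G0 =>
      inner ℝ (indicatorConstLp 2 hs (measure_ne_top volume s) (1 : ℝ)) (toL2 g) := by
    ext g
    rw [L2.inner_indicatorConstLp_one]
    exact setIntegral_congr_ae hs ((MemLp.coeFn_toLp g.memLp).mono fun t ht _ => ht.symm)
  rw [h]
  exact continuous_const.inner continuous_toL2

/-- The points `(k + 1) / (n + 1)`, cut off at `1`. -/
def gridPoint (n k : ℕ) : I := projIcc 0 1 zero_le_one (((k : ℝ) + 1) / (n + 1))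

/-- The first point of the grid of mesh `1 / (n + 1)` to the right of `t`. -/
def gridRight (n : ℕ) (t : I) : I := gridPoint n ⌊(n + 1) * (t : ℝ)⌋₊

theorem gridPoint_pos (n k : ℕ) : 0 < gridPoint n k := by
  have : (0 : ℝ) < ((k : ℝ) + 1) / (n + 1) := by positivity
  rw [gridPoint, ← Subtype.coe_lt_coe, coe_projIcc]
  simp [this]

theorem coe_gridRight (n : ℕ) (t : I) :
    (gridRight n t : ℝ) = min 1 (((⌊(n + 1) * (t : ℝ)⌋₊ : ℝ) + 1) / (n + 1)) := by
  have : (0 : ℝ) ≤ ((⌊(n + 1) * (t : ℝ)⌋₊ : ℝ) + 1) / (n + 1) := by positivity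
  rw [gridRight, gridPoint, coe_projIcc, max_eq_right]
  exact le_min zero_le_one this

theorem le_gridRight (n : ℕ) (t : I) : t ≤ gridRight n t := by
  rw [← Subtype.coe_le_coe, coe_gridRight]
  refine le_min t.2.2 ?_
  rw [le_div_iff₀ (by positivity)]
  linarith [Nat.lt_floor_add_one ((n + 1) * (t : ℝ))]

theorem gridRight_sub_le (n : ℕ) (t : I) : (gridRight n t : ℝ) - t ≤ 1 / (n + 1) := by
  rw [coe_gridRight, sub_le_iff_le_add]
  refine (min_le_right _ _).trans ?_
  have h := Nat.floor_le (mul_nonneg (by positivity) t.2.1 : 0 ≤ ((n : ℝ) + 1) * (t : ℝ))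
  rw [div_le_iff₀ (by positivity), add_mul (1 / ((n : ℝ) + 1)), div_mul_cancel₀ _ (by positivity)]
  linarith

theorem tendsto_gridRight (t : I) : Tendsto (fun n => gridRight n t) atTop (𝓝[≥] t) := by
  refine tendsto_nhdsWithin_iff.2 ⟨?_, Eventually.of_forall fun n => le_gridRight n t⟩
  rw [tendsto_subtype_rng]
  have h := tendsto_one_div_add_atTop_nhds_zero_nat (𝕜 := ℝ)
  refine tendsto_of_tendsto_of_tendsto_of_le_of_le (g := fun _ => (t : ℝ))
    (h := fun n : ℕ => (t : ℝ) + 1 / ((n : ℝ) + 1)) tendsto_const_nhds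
    (by simpa using h.const_add (t : ℝ)) (fun n => le_gridRight n t) fun n => ?_
  have := gridRight_sub_le n t
  simp only
  linarith

theorem tendsto_apply_gridRight (g : G0) (t : I) :
    Tendsto (fun n => (g (gridRight n t) : ℝ)) atTop (𝓝 (g t)) :=
  (continuous_subtype_val.tendsto _).comp ((g.rightCont' t).tendsto.comp (tendsto_gridRight t))

section Measurability

variable {α : Type*} [MeasurableSpace α] {F : α → G0}

/-- Only the end points need an argument: the value at `1` is constant, and the value at `0` is a
limit of values at positive times by right continuity. -/
theorem measurable_apply_of_Ioo (hF : ∀ t ∈ Ioo (0 : I) 1, Measurable fun a => (F a t : ℝ))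
    (t : I) : Measurable fun a => (F a t : ℝ) := by
  have pos : ∀ t : I, 0 < t → Measurable fun a => (F a t : ℝ) := by
    intro t ht
    rcases eq_or_lt_of_le (le_one' (t := t)) with h | h
    · subst h
      simp [map_one']
    · exact hF t ⟨ht, h⟩
  exact measurable_of_tendsto_metrizable (fun n => pos (gridRight n t) (gridPoint_pos _ _))
    (tendsto_pi_nhds.2 fun a => tendsto_apply_gridRight (F a) t)

/-- Rounding the time up to a grid leaves countably many evaluations, and right continuity removes
the rounding in the limit. -/
theorem measurable_uncurry_of_Ioo (hF : ∀ t ∈ Ioo (0 : I) 1, Measurable fun a => (F a t : ℝ)) :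
    Measurable fun p : α × I => (F p.1 p.2 : ℝ) := by
  have step : ∀ n : ℕ, Measurable fun p : α × I => (F p.1 (gridRight n p.2) : ℝ) := by
    intro n
    have h1 : Measurable fun q : α × ℕ => (F q.1 (gridPoint n q.2) : ℝ) :=
      measurable_from_prod_countable_left fun k => measurable_apply_of_Ioo hF (gridPoint n k)
    have h2 : Measurable fun p : α × I => (p.1, ⌊((n : ℝ) + 1) * (p.2 : ℝ)⌋₊) :=
      measurable_fst.prodMk
        (Nat.measurable_floor.comp ((measurable_subtype_coe.comp measurable_snd).const_mul _))
    exact h1.comp h2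
  exact measurable_of_tendsto_metrizable step
    (tendsto_pi_nhds.2 fun p => tendsto_apply_gridRight (F p.1) p.2)

instance : SecondCountableTopology G0 :=
  have : Fact ((2 : ENNReal) ≠ ⊤) := ⟨by norm_num⟩
  (Topology.IsInducing.induced toL2 : Topology.IsInducing toL2).secondCountableTopology

/-- A map into `𝒢₀` is Borel measurable if its evaluations at interior times are. -/
theorem measurable_of_Ioo (hF : ∀ t ∈ Ioo (0 : I) 1, Measurable fun a => (F a t : ℝ)) :
    Measurable F := by
  have hd : ∀ g : G0, Measurable fun a => dist (F a) g := by
    intro g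
    simp_rw [dist_eq]
    have h : Measurable fun p : α × I => ((F p.1 p.2 : ℝ) - g p.2) ^ 2 :=
      ((measurable_uncurry_of_Ioo hF).sub (g.measurable_coe.comp measurable_snd)).pow_const 2
    exact (h.stronglyMeasurable.integral_prod_right (ν := (volume : Measure I))).measurable.sqrt
  refine measurable_of_isOpen fun s hs => ?_
  obtain ⟨D, hDc, hD⟩ := TopologicalSpace.exists_countable_dense G0
  -- By separability an open set is a countable union of balls, so measurability of the distances to
  -- fixed points is enough.
  have hs' : s = ⋃ g ∈ D, ⋃ q : ℚ, ⋃ (_ : Metric.ball g (q : ℝ) ⊆ s), Metric.ball g (q : ℝ) := by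
    ext x
    simp only [mem_iUnion]
    constructor
    · intro hx
      obtain ⟨ε, hε, hεs⟩ := Metric.isOpen_iff.1 hs x hx
      obtain ⟨g, hgD, hg⟩ := hD.exists_dist_lt x (half_pos hε)
      obtain ⟨q, hq1, hq2⟩ := exists_rat_btwn hg
      refine ⟨g, hgD, q, fun y hy => hεs ?_, hq1⟩
      have h1 := dist_triangle y g x
      rw [Metric.mem_ball] at hy ⊢
      rw [dist_comm g x] at h1
      linarith
    · rintro ⟨g, _, q, hq, hx⟩
      exact hq hx
  rw [hs']
  simp only [preimage_iUnion]
  refine MeasurableSet.biUnion hDc fun g _ => MeasurableSet.iUnion fun q =>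
    MeasurableSet.iUnion fun _ => ?_
  exact measurableSet_lt (hd g) measurable_const

end Measurability

/-- Evaluation need not be continuous for the `L²`-metric, but it is the limit of the averages over
intervals shrinking to `t` from the right, and these are continuous. -/
theorem measurable_apply (t : I) : Measurable fun g : G0 => (g t : ℝ) := by
  refine measurable_apply_of_Ioo (F := fun g : G0 => g) (fun t ht => ?_) t
  have key : ∀ g : G0, Tendsto (fun n : ℕ => (volume.real (Ioo t (gridRight n t)))⁻¹ *
      ∫ s in Ioo t (gridRight n t), (g s : ℝ)) atTop (𝓝 (g t)) := by
    intro g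
    have hlt : ∀ n, t < gridRight n t := by
      intro n
      rw [← Subtype.coe_lt_coe, coe_gridRight]
      refine lt_min ht.2 ?_
      rw [lt_div_iff₀ (by positivity)]
      linarith [Nat.lt_floor_add_one (((n : ℝ) + 1) * (t : ℝ))]
    have hpos : ∀ n, 0 < volume.real (Ioo t (gridRight n t)) := by
      intro n
      have h := hlt n
      rw [← Subtype.coe_lt_coe] at h
      rw [Measure.real, unitInterval.volume_Ioo, ENNReal.toReal_ofReal (by linarith)]
      linarith
    have hb : ∀ n, (g t : ℝ) ≤ (volume.real (Ioo t (gridRight n t)))⁻¹ *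
        ∫ s in Ioo t (gridRight n t), (g s : ℝ) := by
      intro n
      rw [← div_eq_inv_mul, le_div_iff₀ (hpos n), mul_comm, ← smul_eq_mul, ← setIntegral_const]
      exact setIntegral_mono_on integrableOn_const g.integrable_coe.integrableOn
        measurableSet_Ioo fun s hs => g.mono' hs.1.le
    have hb' : ∀ n, (volume.real (Ioo t (gridRight n t)))⁻¹ *
        ∫ s in Ioo t (gridRight n t), (g s : ℝ) ≤ g (gridRight n t) := by
      intro n
      rw [← div_eq_inv_mul, div_le_iff₀ (hpos n), mul_comm, ← smul_eq_mul, ← setIntegral_const]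
      exact setIntegral_mono_on g.integrable_coe.integrableOn integrableOn_const
        measurableSet_Ioo fun s hs => g.mono' hs.2.le
    exact tendsto_of_tendsto_of_tendsto_of_le_of_le tendsto_const_nhds
      (tendsto_apply_gridRight g t) hb hb'
  exact measurable_of_tendsto_metrizable
    (fun n => ((continuous_setIntegral_coe measurableSet_Ioo).measurable.const_mul _))
    (tendsto_pi_nhds.2 key)

theorem measurable_uncurry : Measurable fun p : G0 × I => (p.1 p.2 : ℝ) :=
  measurable_uncurry_of_Ioo (F := fun g : G0 => g) fun t _ => measurable_apply t

theorem measurableSpace_eq_comap : instMeasurableSpace =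
    MeasurableSpace.comap (fun (g : G0) (t : Ioo (0 : I) 1) => (g t : ℝ)) MeasurableSpace.pi := by
  refine le_antisymm ?_ ?_
  · have h : @Measurable G0 G0 (MeasurableSpace.comap
        (fun (g : G0) (t : Ioo (0 : I) 1) => (g t : ℝ)) MeasurableSpace.pi) _ fun g => g := by
      refine @measurable_of_Ioo G0 (MeasurableSpace.comap
        (fun (g : G0) (t : Ioo (0 : I) 1) => (g t : ℝ)) MeasurableSpace.pi) (fun g => g) fun t ht => ?_
      exact (@measurable_pi_apply (Ioo (0 : I) 1) (fun _ => ℝ) _ ⟨t, ht⟩).comp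
        (comap_measurable _)
    exact fun s hs => h hs
  · exact (measurable_pi_lambda _ fun t : Ioo (0 : I) 1 => measurable_apply (t : I)).comap_le

/-- Finite measures on `𝒢₀` that agree on all fine enough finite families of interior times are
equal. -/
theorem measure_ext {μ ν : Measure G0} [IsFiniteMeasure μ] [IsFiniteMeasure ν] (T : Finset I)
    (hT : ∀ t ∈ T, t ∈ Ioo (0 : I) 1)
    (h : ∀ (M : ℕ) (τ : Fin M → I), StrictMono τ → (∀ j, τ j ∈ Ioo (0 : I) 1) →
      (∀ t ∈ T, t ∈ range τ) →
      μ.map (fun g j => (g (τ j) : ℝ)) = ν.map (fun g j => (g (τ j) : ℝ))) : μ = ν := by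
  classical
  set E : G0 → Ioo (0 : I) 1 → ℝ := fun g t => (g t : ℝ)
  have hE : Measurable E := measurable_pi_lambda _ fun t => measurable_apply t
  have key : μ.map E = ν.map E := by
    refine IsProjectiveLimit.unique (P := fun J => (ν.map E).map J.restrict) (fun J => ?_)
      fun J => rfl
    have hr : Measurable (J.restrict : (Ioo (0 : I) 1 → ℝ) → J → ℝ) :=
      Finset.measurable_restrict J
    change _ = (ν.map E).map J.restrict
    rw [Measure.map_map hr hE, Measure.map_map hr hE]
    -- The times of `J` are enlarged by `T` and sorted, so that the hypothesis applies; the marginal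
    -- on `J` is then a projection.
    set S : Finset I := J.image Subtype.val ∪ T
    have hS : ∀ t ∈ S, t ∈ Ioo (0 : I) 1 := by
      intro t ht
      rcases Finset.mem_union.1 ht with ht | ht
      · obtain ⟨s, _, rfl⟩ := Finset.mem_image.1 ht
        exact s.2
      · exact hT t ht
    set τ : Fin S.card → I := fun j => S.orderEmbOfFin rfl j
    have hτr : range τ = (S : Set I) := Finset.range_orderEmbOfFin S rfl
    have h1 := h S.card τ (S.orderEmbOfFin rfl).strictMono
      (fun j => hS _ (Finset.orderEmbOfFin_mem S rfl j))
      (fun t ht => by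
        rw [hτr]
        exact Finset.mem_coe.2 (Finset.mem_union_right _ ht))
    have hidx : ∀ t : J, ∃ j, τ j = (t : Ioo (0 : I) 1) := by
      intro t
      have : ((t : Ioo (0 : I) 1) : I) ∈ range τ := by
        rw [hτr]
        exact Finset.mem_coe.2 (Finset.mem_union_left _ (Finset.mem_image_of_mem _ t.2))
      exact this
    choose k hk using hidx
    have hτm : Measurable fun (g : G0) (j : Fin S.card) => (g (τ j) : ℝ) :=
      measurable_pi_lambda _ fun j => measurable_apply _
    have hcomp : J.restrict ∘ E = (fun (x : Fin S.card → ℝ) (t : J) => x (k t)) ∘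
        fun (g : G0) (j : Fin S.card) => (g (τ j) : ℝ) := by
      ext g t
      simp [E, hk]
    have hkm : Measurable fun (x : Fin S.card → ℝ) (t : J) => x (k t) :=
      measurable_pi_lambda _ fun t => measurable_pi_apply _
    rw [hcomp, ← Measure.map_map hkm hτm, ← Measure.map_map hkm hτm, h1]
  ext s hs
  change MeasurableSet[instMeasurableSpace] s at hs
  rw [measurableSpace_eq_comap] at hs
  obtain ⟨A, hA, rfl⟩ := hs
  rw [← Measure.map_apply hE hA, key, Measure.map_apply hE hA]

end G0

/-! ### Dirichlet densities through their homogeneous extension to the cone of increasing vectors.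
-/

section Increments

variable {M : ℕ}

/-- The increments `S₀ - 0, S₁ - S₀, …` of a vector. -/
def incr (M : ℕ) : (Fin (M + 1) → ℝ) →ₗ[ℝ] (Fin (M + 1) → ℝ) where
  toFun S m := S m - (Fin.cons 0 S : Fin (M + 2) → ℝ) m.castSucc
  map_add' S S' := by
    ext m
    refine Fin.cases ?_ (fun i => ?_) m
    · simp
    · simp only [Pi.add_apply, ← Fin.succ_castSucc, Fin.cons_succ]
      ring
  map_smul' a S := by
    ext m
    refine Fin.cases ?_ (fun i => ?_) m
    · simp
    · simp only [Pi.smul_apply, ← Fin.succ_castSucc, Fin.cons_succ, smul_eq_mul, RingHom.id_apply]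
      ring

theorem incr_apply (S : Fin (M + 1) → ℝ) (m : Fin (M + 1)) :
    incr M S m = S m - (Fin.cons 0 S : Fin (M + 2) → ℝ) m.castSucc := rfl

@[simp]
theorem incr_zero (S : Fin (M + 1) → ℝ) : incr M S 0 = S 0 := by simp [incr_apply]

@[simp]
theorem incr_succ (S : Fin (M + 1) → ℝ) (i : Fin M) :
    incr M S i.succ = S i.succ - S i.castSucc := by
  rw [incr_apply, ← Fin.succ_castSucc, Fin.cons_succ]

theorem incr_injective : Function.Injective (incr M) := by
  rw [injective_iff_map_eq_zero]
  intro S hS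
  ext m
  refine Fin.induction ?_ (fun i hi => ?_) m
  · simpa using congrFun hS 0
  · have := congrFun hS i.succ
    rw [incr_succ, hi] at this
    simpa using this

/-- `incr` as a linear equivalence. -/
def incrEquiv (M : ℕ) : (Fin (M + 1) → ℝ) ≃ₗ[ℝ] (Fin (M + 1) → ℝ) :=
  LinearEquiv.ofInjectiveEndo (incr M) incr_injective

/-- The linear map that multiplies the increments of a vector by the weights `r`. -/
def scaleIncr (r : Fin (M + 1) → ℝ) : (Fin (M + 1) → ℝ) →ₗ[ℝ] (Fin (M + 1) → ℝ) :=
  ((incrEquiv M).symm : _ →ₗ[ℝ] _) ∘ₗ Matrix.toLin' (Matrix.diagonal r) ∘ₗ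
    (incrEquiv M : _ →ₗ[ℝ] _)

theorem incr_scaleIncr (r S : Fin (M + 1) → ℝ) (m : Fin (M + 1)) :
    incr M (scaleIncr r S) m = r m * incr M S m := by
  have h : incrEquiv M (scaleIncr r S) = Matrix.toLin' (Matrix.diagonal r) (incrEquiv M S) := by
    simp [scaleIncr]
  have h' := congrFun h m
  rw [Matrix.toLin'_apply, Matrix.mulVec_diagonal] at h'
  exact h'

theorem det_scaleIncr (r : Fin (M + 1) → ℝ) : LinearMap.det (scaleIncr r) = ∏ m, r m := by
  have h := LinearMap.det_conj (Matrix.toLin' (Matrix.diagonal r)) (incrEquiv M).symm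
  rw [LinearEquiv.symm_symm] at h
  rw [scaleIncr, h, LinearMap.det_toLin', Matrix.det_diagonal]

theorem measurable_incr (m : Fin (M + 1)) : Measurable fun S => incr M S m :=
  (measurable_pi_apply m).comp (LinearMap.continuous_of_finiteDimensional (incr M)).measurable

/-- The cone of the vectors with positive increments. -/
def incrCone (M : ℕ) : Set (Fin (M + 1) → ℝ) := {S | ∀ m, 0 < incr M S m}

theorem measurableSet_incrCone : MeasurableSet (incrCone M) := by
  rw [incrCone, ofPred_forall]
  exact MeasurableSet.iInter fun m => measurableSet_lt measurable_const (measurable_incr m)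

theorem strictMono_cons_iff (S : Fin (M + 1) → ℝ) :
    StrictMono (Fin.cons 0 S : Fin (M + 2) → ℝ) ↔ S ∈ incrCone M := by
  rw [Fin.strictMono_iff_lt_succ]
  exact forall_congr' fun m => by rw [Fin.cons_succ, incr_apply, sub_pos]

theorem last_pos_of_mem_incrCone {S : Fin (M + 1) → ℝ} (hS : S ∈ incrCone M) :
    0 < S (Fin.last M) := by
  have h := (strictMono_cons_iff S).2 hS (Fin.succ_pos (Fin.last M))
  simpa using h

theorem smul_mem_incrCone {S : Fin (M + 1) → ℝ} {x : ℝ} (hx : 0 < x) :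
    x • S ∈ incrCone M ↔ S ∈ incrCone M := by
  simp [incrCone, hx]

theorem scaleIncr_mem_incrCone {r S : Fin (M + 1) → ℝ} (hr : ∀ m, 0 < r m) :
    scaleIncr r S ∈ incrCone M ↔ S ∈ incrCone M := by
  simp [incrCone, incr_scaleIncr, hr]

open Classical in
/-- The homogeneous extension of the unnormalized Dirichlet density. -/
def coneDensity (a S : Fin (M + 1) → ℝ) : ℝ :=
  if S ∈ incrCone M then ∏ m, incr M S m ^ (a m - 1) else 0

theorem coneDensity_nonneg (a S : Fin (M + 1) → ℝ) : 0 ≤ coneDensity a S := by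
  rw [coneDensity]
  split_ifs with h
  · exact Finset.prod_nonneg fun m _ => Real.rpow_nonneg (h m).le _
  · exact le_rfl

theorem coneDensity_of_notMem {a S : Fin (M + 1) → ℝ} (hS : S ∉ incrCone M) :
    coneDensity a S = 0 := by
  rw [coneDensity, if_neg hS]

theorem measurable_coneDensity (a : Fin (M + 1) → ℝ) : Measurable (coneDensity a) := by
  unfold coneDensity
  exact Measurable.ite measurableSet_incrCone
    (Finset.measurable_fun_prod _ fun m _ => (measurable_incr m).pow_const _) measurable_const

theorem coneDensity_smul (a S : Fin (M + 1) → ℝ) {x : ℝ} (hx : 0 < x) :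
    coneDensity a (x • S) = x ^ (∑ m, a m - (M + 1)) * coneDensity a S := by
  rw [coneDensity, coneDensity, smul_mem_incrCone hx]
  split_ifs with h
  · simp only [map_smul, Pi.smul_apply, smul_eq_mul]
    rw [Finset.prod_congr rfl fun m _ => Real.mul_rpow hx.le (h m).le, Finset.prod_mul_distrib,
      ← Real.rpow_sum_of_pos hx]
    simp [Finset.sum_sub_distrib]
  · simp

theorem coneDensity_scaleIncr (a S : Fin (M + 1) → ℝ) {r : Fin (M + 1) → ℝ} (hr : ∀ m, 0 < r m) :
    coneDensity a (scaleIncr r S) = (∏ m, r m ^ (a m - 1)) * coneDensity a S := by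
  rw [coneDensity, coneDensity, scaleIncr_mem_incrCone hr]
  split_ifs with h
  · simp only [incr_scaleIncr]
    rw [Finset.prod_congr rfl fun m _ => Real.mul_rpow (hr m).le (h m).le,
      Finset.prod_mul_distrib]
  · simp

theorem lintegral_comp_smul_of_pos (f : (Fin M → ℝ) → ENNReal) (hf : Measurable f) {x : ℝ}
    (hx : 0 < x) : ∫⁻ z, f z = ENNReal.ofReal (x ^ M) * ∫⁻ z, f (x • z) := by
  have h := Measure.map_addHaar_smul (volume : Measure (Fin M → ℝ)) hx.ne'
  have h2 : ∫⁻ z, f (x • z) = ∫⁻ z, f z ∂(Measure.map (x • ·) volume) := by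
    rw [lintegral_map hf (measurable_const_smul x)]
  rw [h2, h, lintegral_smul_measure, Module.finrank_fin_fun, smul_eq_mul, ← mul_assoc,
    ← ENNReal.ofReal_mul (by positivity), abs_of_pos (by positivity),
    mul_inv_cancel₀ (by positivity), ENNReal.ofReal_one, one_mul]

theorem smul_snoc_one (x : ℝ) (z : Fin M → ℝ) :
    x • (Fin.snoc z 1 : Fin (M + 1) → ℝ) = Fin.snoc (x • z) x := by
  ext m
  refine Fin.lastCases ?_ (fun i => ?_) m <;> simp

/-- Polar coordinates in which the last coordinate is the radius: the slice at height `x` is `x`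
times the slice at height `1`, which gives the Jacobian `x ^ M`. -/
theorem lintegral_eq_lintegral_Ioi_smul_snoc (H : (Fin (M + 1) → ℝ) → ENNReal) (hH : Measurable H)
    (h0 : ∀ S, S (Fin.last M) ≤ 0 → H S = 0) :
    ∫⁻ S, H S = ∫⁻ x in Ioi (0 : ℝ), ENNReal.ofReal (x ^ M) *
      ∫⁻ z : Fin M → ℝ, H (x • Fin.snoc z 1) := by
  have e := (volume_preserving_piFinSuccAbove (fun _ : Fin (M + 1) => ℝ) (Fin.last M)).symm
  rw [← e.lintegral_comp hH, Measure.volume_eq_prod,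
    lintegral_prod (fun q => H ((MeasurableEquiv.piFinSuccAbove (fun _ : Fin (M + 1) => ℝ)
      (Fin.last M)).symm q)) (hH.comp e.measurable).aemeasurable,
    ← lintegral_indicator measurableSet_Ioi]
  refine lintegral_congr fun x => ?_
  have hs : ∀ z : Fin M → ℝ, (MeasurableEquiv.piFinSuccAbove (fun _ : Fin (M + 1) => ℝ)
      (Fin.last M)).symm (x, z) = Fin.snoc z x := by
    intro z
    simp only [MeasurableEquiv.piFinSuccAbove_symm_apply]
    exact Fin.insertNth_last' x z
  simp only [hs]
  by_cases hx : 0 < x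
  · rw [indicator_of_mem (mem_Ioi.2 hx)]
    have hm : Measurable fun z : Fin M → ℝ => H (Fin.snoc z x) := by
      simp only [← hs]
      exact hH.comp (e.measurable.comp (measurable_const.prodMk measurable_id))
    rw [lintegral_comp_smul_of_pos _ hm hx]
    simp only [smul_snoc_one]
  · rw [indicator_of_notMem (by simpa using hx)]
    have : ∀ z : Fin M → ℝ, H (Fin.snoc z x) = 0 := fun z => h0 _ (by simpa using hx)
    simp [this]

theorem lintegral_rpow_mul_exp {b R : ℝ} (hb : 0 < b) (hR : 0 < R) :
    ∫⁻ x in Ioi (0 : ℝ), ENNReal.ofReal (x ^ (b - 1) * Real.exp (-(R * x))) =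
      ENNReal.ofReal (Real.Gamma b) * ENNReal.ofReal (R ^ (-b)) := by
  have h := Real.integral_rpow_mul_exp_neg_mul_Ioi hb hR
  have hpos : (0 : ℝ) < (1 / R) ^ b * Real.Gamma b :=
    mul_pos (by positivity) (Real.Gamma_pos_of_pos hb)
  -- The integral of a nonintegrable function is `0` by convention, whereas this one has a positive
  -- value.
  have hi : IntegrableOn (fun x : ℝ => x ^ (b - 1) * Real.exp (-(R * x))) (Ioi 0) := by
    by_contra hn
    rw [integral_undef hn] at h
    exact hpos.ne h
  rw [← ofReal_integral_eq_lintegral_ofReal hi, h, ← ENNReal.ofReal_mul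
    (Real.Gamma_pos_of_pos hb).le, one_div, Real.inv_rpow hR.le, Real.rpow_neg hR.le, mul_comm]
  filter_upwards [ae_restrict_mem measurableSet_Ioi] with x hx
  have : (0 : ℝ) < x := hx
  positivity

theorem measurable_snoc_one :
    Measurable fun z : Fin M → ℝ => (Fin.snoc z 1 : Fin (M + 1) → ℝ) := by
  refine measurable_pi_lambda _ fun m => ?_
  refine Fin.lastCases ?_ (fun i => ?_) m
  · simp
  · simpa using measurable_pi_apply i

/-- Integration of the radial variable in the homogeneous extension. -/
theorem lintegral_exp_coneDensity (a : Fin (M + 1) → ℝ) (ha : 0 < ∑ m, a m)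
    (K : (Fin (M + 1) → ℝ) → ENNReal) (hK : Measurable K)
    (hKs : ∀ S (x : ℝ), 0 < x → K (x • S) = K S)
    (R : (Fin (M + 1) → ℝ) →ₗ[ℝ] ℝ) (hR : ∀ S ∈ incrCone M, 0 < R S) :
    ∫⁻ S, K S * ENNReal.ofReal (Real.exp (-R S) * coneDensity a S) =
      ENNReal.ofReal (Real.Gamma (∑ m, a m)) * ∫⁻ z : Fin M → ℝ, K (Fin.snoc z 1) *
        ENNReal.ofReal (R (Fin.snoc z 1) ^ (-∑ m, a m) * coneDensity a (Fin.snoc z 1)) := by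
  have hRm : Measurable R := (LinearMap.continuous_of_finiteDimensional R).measurable
  have hm : Measurable fun S => K S * ENNReal.ofReal (Real.exp (-R S) * coneDensity a S) :=
    hK.mul (hRm.neg.exp.mul (measurable_coneDensity a)).ennreal_ofReal
  rw [lintegral_eq_lintegral_Ioi_smul_snoc _ hm]
  swap
  · intro S hS
    rw [coneDensity_of_notMem fun h => (last_pos_of_mem_incrCone h).not_ge hS]
    simp
  have h1 : ∀ x ∈ Ioi (0 : ℝ), ENNReal.ofReal (x ^ M) * ∫⁻ z : Fin M → ℝ,
      K (x • Fin.snoc z 1) * ENNReal.ofReal (Real.exp (-R (x • Fin.snoc z 1)) *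
        coneDensity a (x • Fin.snoc z 1)) =
      ∫⁻ z : Fin M → ℝ, (K (Fin.snoc z 1) * ENNReal.ofReal (coneDensity a (Fin.snoc z 1))) *
        ENNReal.ofReal (x ^ (∑ m, a m - 1) * Real.exp (-(R (Fin.snoc z 1) * x))) := by
    intro x hx
    have hx : (0 : ℝ) < x := hx
    rw [← lintegral_const_mul' _ _ ENNReal.ofReal_ne_top]
    refine lintegral_congr fun z => ?_
    rw [hKs _ _ hx, coneDensity_smul _ _ hx, map_smul, smul_eq_mul, mul_left_comm, mul_assoc,
      ← ENNReal.ofReal_mul (by positivity), ← ENNReal.ofReal_mul (coneDensity_nonneg _ _)]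
    congr 2
    -- The Jacobian `x ^ M` and the homogeneity degree `∑ a - (M + 1)` combine to the gamma exponent
    -- `∑ a - 1`.
    rw [mul_comm x (R _), show ∑ m, a m - 1 = (M : ℝ) + (∑ m, a m - (M + 1)) by ring,
      Real.rpow_add hx, Real.rpow_natCast]
    ring
  rw [setLIntegral_congr_fun measurableSet_Ioi h1, lintegral_lintegral_swap]
  · rw [← lintegral_const_mul' _ _ ENNReal.ofReal_ne_top]
    refine lintegral_congr fun z => ?_
    by_cases hz : (Fin.snoc z 1 : Fin (M + 1) → ℝ) ∈ incrCone M
    · rw [lintegral_const_mul'' _ (Measurable.aemeasurable (by fun_prop)),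
        lintegral_rpow_mul_exp ha (hR _ hz),
        ENNReal.ofReal_mul (p := R (Fin.snoc z 1) ^ (-∑ m, a m))
          (Real.rpow_nonneg (hR _ hz).le _)]
      ring
    · simp [coneDensity_of_notMem hz]
  · refine Measurable.aemeasurable ?_
    have hsn2 : Measurable fun p : ℝ × (Fin M → ℝ) => (Fin.snoc p.2 1 : Fin (M + 1) → ℝ) :=
      measurable_snoc_one.comp measurable_snd
    refine ((hK.comp hsn2).mul ((measurable_coneDensity a).comp hsn2).ennreal_ofReal).mul ?_
    exact ((measurable_fst.pow_const _).mul
      (((hRm.comp hsn2).mul measurable_fst).neg.exp)).ennreal_ofReal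

/-- The first coordinates of a vector, normalized by its last one. -/
def normalizeLast (S : Fin (M + 1) → ℝ) : Fin M → ℝ := fun j => S j.castSucc / S (Fin.last M)

theorem measurable_normalizeLast : Measurable (normalizeLast (M := M)) :=
  measurable_pi_lambda _ fun _ => (measurable_pi_apply _).div (measurable_pi_apply _)

theorem normalizeLast_smul (S : Fin (M + 1) → ℝ) {x : ℝ} (hx : 0 < x) :
    normalizeLast (x • S) = normalizeLast S := by
  ext j
  simp only [normalizeLast, Pi.smul_apply, smul_eq_mul]
  rw [mul_div_mul_left _ _ hx.ne']

theorem normalizeLast_snoc (z : Fin M → ℝ) :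
    normalizeLast (Fin.snoc z 1 : Fin (M + 1) → ℝ) = z := by
  ext j
  simp [normalizeLast]

/-- The Dirichlet density under a reweighting of the increments. -/
theorem lintegral_scaleIncr (a r : Fin (M + 1) → ℝ) (ha : 0 < ∑ m, a m) (hr : ∀ m, 0 < r m)
    (F : (Fin M → ℝ) → ENNReal) (hF : Measurable F) :
    ∫⁻ z : Fin M → ℝ, F (normalizeLast (scaleIncr r (Fin.snoc z 1))) *
        ENNReal.ofReal (scaleIncr r (Fin.snoc z 1) (Fin.last M) ^ (-∑ m, a m) *
          coneDensity a (Fin.snoc z 1)) =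
      ENNReal.ofReal (∏ m, r m ^ (a m))⁻¹ *
        ∫⁻ z : Fin M → ℝ, F z * ENNReal.ofReal (coneDensity a (Fin.snoc z 1)) := by
  set L := scaleIncr r
  set π : (Fin (M + 1) → ℝ) →ₗ[ℝ] ℝ := LinearMap.proj (Fin.last M)
  have hLm : Measurable L := (LinearMap.continuous_of_finiteDimensional L).measurable
  -- `G` carries the unnormalized law of independent gamma increments with parameters `a`. Its
  -- integral along `L` is computed twice: by the linear change of variables and by integrating out
  -- the radius.
  set G : (Fin (M + 1) → ℝ) → ENNReal := fun S =>
    F (normalizeLast S) * ENNReal.ofReal (Real.exp (-π S) * coneDensity a S)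
  have hGm : Measurable G := (hF.comp measurable_normalizeLast).mul
    ((measurable_pi_apply (Fin.last M)).neg.exp.mul (measurable_coneDensity a)).ennreal_ofReal
  have h1 := lintegral_exp_coneDensity a ha (fun S => F (normalizeLast S))
    (hF.comp measurable_normalizeLast) (fun S x hx => by rw [normalizeLast_smul S hx]) π
    (fun S hS => last_pos_of_mem_incrCone hS)
  have h2 := lintegral_exp_coneDensity a ha (fun S => F (normalizeLast (L S)))
    (hF.comp (measurable_normalizeLast.comp hLm))
    (fun S x hx => by simp only [map_smul]; rw [normalizeLast_smul _ hx]) (π ∘ₗ L)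
    (fun S hS => last_pos_of_mem_incrCone ((scaleIncr_mem_incrCone hr).2 hS))
  have hdet : LinearMap.det L ≠ 0 := by
    rw [det_scaleIncr]
    exact (Finset.prod_pos fun m _ => hr m).ne'
  have hp : (0 : ℝ) < ∏ m, r m := Finset.prod_pos fun m _ => hr m
  have hq : (0 : ℝ) < ∏ m, r m ^ (a m - 1) := Finset.prod_pos fun m _ =>
    Real.rpow_pos_of_pos (hr m) _
  have h3 : ∫⁻ S, G (L S) = ENNReal.ofReal (∏ m, r m)⁻¹ * ∫⁻ S, G S := by
    rw [← lintegral_map hGm hLm, Measure.map_linearMap_addHaar_eq_smul_addHaar _ hdet,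
      lintegral_smul_measure, det_scaleIncr, abs_of_pos (inv_pos.2 hp), smul_eq_mul]
  have h4 : ∫⁻ S, G (L S) = ENNReal.ofReal (∏ m, r m ^ (a m - 1)) *
      ∫⁻ S, F (normalizeLast (L S)) *
        ENNReal.ofReal (Real.exp (-(π ∘ₗ L) S) * coneDensity a S) := by
    rw [← lintegral_const_mul' _ _ ENNReal.ofReal_ne_top]
    refine lintegral_congr fun S => ?_
    simp only [G]
    rw [coneDensity_scaleIncr a S hr, mul_left_comm (Real.exp _), ENNReal.ofReal_mul hq.le,
      mul_left_comm]
    rfl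
  rw [h4, h2] at h3
  change _ = _ * ∫⁻ S, F (normalizeLast S) * ENNReal.ofReal (Real.exp (-π S) * coneDensity a S)
    at h3
  rw [h1] at h3
  have hπ : ∀ z : Fin M → ℝ, π (Fin.snoc z 1 : Fin (M + 1) → ℝ) = 1 := fun z => by simp [π]
  simp only [hπ, Real.one_rpow, one_mul, normalizeLast_snoc] at h3
  have hΓ : ENNReal.ofReal (Real.Gamma (∑ m, a m)) ≠ 0 := by
    simpa using Real.Gamma_pos_of_pos ha
  have hq' : ENNReal.ofReal (∏ m, r m ^ (a m - 1)) ≠ 0 := by simpa using hq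
  -- The radial integrations on both sides produce the same gamma factor, which cancels.
  rw [mul_left_comm, mul_left_comm (ENNReal.ofReal (∏ m, r m)⁻¹),
    ENNReal.mul_right_inj hΓ ENNReal.ofReal_ne_top] at h3
  refine (ENNReal.mul_right_inj hq' ENNReal.ofReal_ne_top).1 (Eq.trans h3 ?_)
  rw [← mul_assoc, ← ENNReal.ofReal_mul hq.le]
  congr 2
  simp only [Real.rpow_sub_one (hr _).ne', Finset.prod_div_distrib]
  have : (0 : ℝ) < ∏ m, r m ^ (a m) := Finset.prod_pos fun m _ => Real.rpow_pos_of_pos (hr m) _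
  field_simp

end Increments

/-! ### Integration of step functions against `dg` and the reweighting map. -/

section StepWeight

variable {n : ℕ} (p : Fin n → I) (c₀ : ℝ) (c : Fin n → ℝ)

/-- The step function `c₀ + ∑ₖ cₖ 1_{[0, pₖ]}`. -/
def stepFun (t : I) : ℝ := c₀ + ∑ k, if t ≤ p k then c k else 0

/-- The Stieltjes integral `∫_{[0,t]} f dg` of the step function `f = c₀ + ∑ₖ cₖ 1_{[0, pₖ]}`. -/
def stepInt (g : G0) (t : I) : ℝ := c₀ * g t + ∑ k, c k * g (min t (p k))

variable {p c₀ c}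

/-- No breakpoint lies strictly between `s` and `t`, so the step function is constant on `(s, t]`.
-/
theorem stepInt_sub (g : G0) {s t : I} (hst : s ≤ t) (h : ∀ k, p k ≤ s ∨ t ≤ p k) :
    stepInt p c₀ c g t - stepInt p c₀ c g s = stepFun p c₀ c t * (g t - g s) := by
  rw [stepInt, stepInt, stepFun, add_mul, add_sub_add_comm, ← mul_sub, Finset.sum_mul,
    ← Finset.sum_sub_distrib]
  congr 1
  refine Finset.sum_congr rfl fun k _ => ?_
  rcases h k with hk | hk
  · rw [min_eq_right hk, min_eq_right (hk.trans hst), sub_self]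
    split_ifs with h'
    · rw [le_antisymm hst (h'.trans hk)]
      simp
    · simp
  · rw [min_eq_left hk, min_eq_left (hst.trans hk), if_pos hk, mul_sub]

theorem stepInt_of_le (g : G0) {t : I} (h : ∀ k, t ≤ p k) :
    stepInt p c₀ c g t = stepFun p c₀ c t * g t := by
  simp [stepInt, stepFun, h, add_mul, Finset.sum_mul]

/-- Induction on the number of breakpoints strictly between the two times, splitting at one of them;
with none left the increment is a nonnegative multiple of that of `g`. -/
theorem stepInt_mono (hf : ∀ t, 0 ≤ stepFun p c₀ c t) (g : G0) :
    Monotone (stepInt p c₀ c g) := by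
  have key : ∀ (N : ℕ) (s t : I), s ≤ t → (Finset.univ.filter fun k => s < p k ∧ p k < t).card ≤ N →
      stepInt p c₀ c g s ≤ stepInt p c₀ c g t := by
    intro N
    induction N with
    | zero =>
      intro s t hst hN
      rw [Nat.le_zero, Finset.card_eq_zero, Finset.filter_eq_empty_iff] at hN
      have h := stepInt_sub (c₀ := c₀) (c := c) g hst fun k => by
        have := hN (Finset.mem_univ k)
        by_contra! h'
        exact this h'
      have h2 : (g s : ℝ) ≤ g t := g.mono' hst
      linarith [mul_nonneg (hf t) (sub_nonneg.2 h2)]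
    | succ N ih =>
      intro s t hst hN
      by_cases hk : ∃ k, s < p k ∧ p k < t
      · obtain ⟨k, hk1, hk2⟩ := hk
        have hkt : k ∈ Finset.univ.filter fun k => s < p k ∧ p k < t := by simp [hk1, hk2]
        refine (ih s (p k) hk1.le ?_).trans (ih (p k) t hk2.le ?_)
        · refine Nat.le_of_lt_succ (lt_of_lt_of_le (Finset.card_lt_card ?_) hN)
          refine (Finset.ssubset_iff_of_subset fun l hl => ?_).2 ⟨k, hkt, by simp⟩
          simp only [Finset.mem_filter, Finset.mem_univ, true_and] at hl ⊢
          exact ⟨hl.1, hl.2.trans hk2⟩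
        · refine Nat.le_of_lt_succ (lt_of_lt_of_le (Finset.card_lt_card ?_) hN)
          refine (Finset.ssubset_iff_of_subset fun l hl => ?_).2 ⟨k, hkt, by simp⟩
          simp only [Finset.mem_filter, Finset.mem_univ, true_and] at hl ⊢
          exact ⟨hk1.trans hl.1, hl.2⟩
      · refine ih s t hst ?_
        rw [Finset.filter_eq_empty_iff.2 fun k _ h => hk ⟨k, h⟩]
        simp
  exact fun s t hst => key _ s t hst le_rfl

theorem stepInt_nonneg (hf : ∀ t, 0 ≤ stepFun p c₀ c t) (g : G0) (t : I) :
    0 ≤ stepInt p c₀ c g t := by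
  refine le_trans ?_ (stepInt_mono hf g (nonneg' : 0 ≤ t))
  rw [stepInt_of_le g fun k => nonneg']
  exact mul_nonneg (hf 0) (g 0).2.1

theorem stepInt_continuousWithinAt (g : G0) (t : I) :
    ContinuousWithinAt (stepInt p c₀ c g) (Ici t) t := by
  have hg : ∀ t, ContinuousWithinAt (fun s => (g s : ℝ)) (Ici t) t := fun t =>
    continuous_subtype_val.continuousAt.comp_continuousWithinAt (g.rightCont' t)
  refine (continuousWithinAt_const.mul (hg t)).add
    (tendsto_finsetSum _ fun k _ => continuousWithinAt_const.mul ?_)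
  have hm : Continuous fun s : I => min s (p k) := continuous_id.min continuous_const
  exact ContinuousWithinAt.comp (f := fun s : I => min s (p k)) (hg (min t (p k)))
    hm.continuousWithinAt fun s hs => min_le_min_right (p k) hs

theorem measurable_stepInt (t : I) : Measurable fun g => stepInt p c₀ c g t :=
  ((G0.measurable_apply t).const_mul _).add
    (Finset.measurable_fun_sum _ fun k _ => (G0.measurable_apply (min t (p k))).const_mul _)

end StepWeight

/-- A step function on `[0,1]` with values in `[lo, hi]`, where `0 < lo`. -/
structure StepWeight (n : ℕ) where
  p : Fin n → I
  c₀ : ℝ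
  c : Fin n → ℝ
  lo : ℝ
  hi : ℝ
  p_mem : ∀ k, p k ∈ Ioo (0 : I) 1
  lo_pos : 0 < lo
  lo_le : ∀ t, lo ≤ stepFun p c₀ c t
  le_hi : ∀ t, stepFun p c₀ c t ≤ hi

namespace StepWeight

variable {n : ℕ} (w : StepWeight n)

theorem stepFun_pos (t : I) : 0 < stepFun w.p w.c₀ w.c t := w.lo_pos.trans_le (w.lo_le t)

/-- The total mass of `f dg`. -/
def mass (g : G0) : ℝ := stepInt w.p w.c₀ w.c g 1

/-- The step function minus `lo` is nonnegative, hence so is its integral, and `dg` has total mass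
`1` (with the mass at `0` counted). The upper bound uses `hi` minus the step function. -/
theorem lo_le_mass (g : G0) : w.lo ≤ w.mass g := by
  have h := stepInt_nonneg (p := w.p) (c₀ := w.c₀ - w.lo) (c := w.c)
    (fun t => by have := w.lo_le t; rw [stepFun] at this ⊢; linarith) g 1
  rw [mass]
  rw [stepInt, g.map_one'] at h ⊢
  simp only [Icc.coe_one] at h ⊢
  linarith

theorem mass_le_hi (g : G0) : w.mass g ≤ w.hi := by
  have h := stepInt_nonneg (p := w.p) (c₀ := w.hi - w.c₀) (c := fun k => -w.c k)
    (fun t => by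
      have := w.le_hi t
      rw [stepFun] at this ⊢
      have h2 : (∑ k, if t ≤ w.p k then -w.c k else 0) = -∑ k, if t ≤ w.p k then w.c k else 0 := by
        rw [← Finset.sum_neg_distrib]
        exact Finset.sum_congr rfl fun k _ => by split_ifs <;> simp
      rw [h2]
      linarith) g 1
  rw [mass]
  rw [stepInt, g.map_one'] at h ⊢
  simp only [Icc.coe_one, neg_mul, Finset.sum_neg_distrib] at h ⊢
  linarith

theorem mass_pos (g : G0) : 0 < w.mass g := w.lo_pos.trans_le (w.lo_le_mass g)

theorem measurable_mass : Measurable w.mass := measurable_stepInt 1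

theorem stepInt_div_mem (g : G0) (t : I) : stepInt w.p w.c₀ w.c g t / w.mass g ∈ Icc (0 : ℝ) 1 :=
  ⟨div_nonneg (stepInt_nonneg (fun t => (w.stepFun_pos t).le) g t) (w.mass_pos g).le,
    (div_le_one (w.mass_pos g)).2 (stepInt_mono (fun t => (w.stepFun_pos t).le) g le_one')⟩

/-- The map `g ↦ ∫_{[0,t]} f dg / ∫_{[0,1]} f dg` on `𝒢₀`. -/
def reweight (g : G0) : G0 where
  toFun t := ⟨stepInt w.p w.c₀ w.c g t / w.mass g, w.stepInt_div_mem g t⟩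
  mono' s t hst := Subtype.coe_le_coe.1
    (div_le_div_of_nonneg_right (stepInt_mono (fun t => (w.stepFun_pos t).le) g hst)
      (w.mass_pos g).le)
  rightCont' t := by
    rw [ContinuousWithinAt, tendsto_subtype_rng]
    exact (stepInt_continuousWithinAt g t).div_const _
  map_one' := Subtype.ext (div_self (w.mass_pos g).ne')

theorem reweight_apply (g : G0) (t : I) :
    (w.reweight g t : ℝ) = stepInt w.p w.c₀ w.c g t / w.mass g := rfl

theorem measurable_reweight : Measurable w.reweight :=
  G0.measurable_of_Ioo fun t _ => (measurable_stepInt t).div w.measurable_mass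

/-- If the grid contains all breakpoints, the step function is constant on each cell, so reweighting
acts on the grid values by scaling their increments. -/
theorem stepInt_grid {M : ℕ} (τ : Fin (M + 1) → I) (hτ : StrictMono τ)
    (hp : ∀ k, w.p k ∈ range τ) (g : G0) :
    (fun m => stepInt w.p w.c₀ w.c g (τ m)) =
      scaleIncr (fun m => stepFun w.p w.c₀ w.c (τ m)) fun m => (g (τ m) : ℝ) := by
  apply incr_injective
  ext m
  rw [incr_scaleIncr]
  refine Fin.cases ?_ (fun i => ?_) m
  · rw [incr_zero, incr_zero]
    refine stepInt_of_le g fun k => ?_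
    obtain ⟨j, hj⟩ := hp k
    rw [← hj]
    exact hτ.monotone (Fin.zero_le j)
  · rw [incr_succ, incr_succ]
    refine stepInt_sub g (hτ.monotone i.castSucc_lt_succ.le) fun k => ?_
    obtain ⟨j, hj⟩ := hp k
    rw [← hj, hτ.le_iff_le, hτ.le_iff_le]
    rcases le_or_gt j i.castSucc with h | h
    · exact Or.inl h
    · exact Or.inr (Fin.castSucc_lt_iff_succ_le.1 h)

end StepWeight

/-! ### Quasi-invariance of the Dirichlet process. -/

theorem Fin.sum_succ_sub_castSucc {M : ℕ} (f : Fin (M + 1) → ℝ) :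
    ∑ i : Fin M, (f i.succ - f i.castSucc) = f (Fin.last M) - f 0 := by
  induction M with
  | zero => simp
  | succ M ih =>
    have h := ih fun i => f i.castSucc
    rw [Fin.sum_univ_castSucc]
    simp only [← Fin.succ_castSucc] at h ⊢
    rw [h]
    simp

theorem strictMono_snoc_one {M : ℕ} {τ : Fin M → I} (hτ : StrictMono τ) (h1 : ∀ j, τ j < 1) :
    StrictMono (Fin.snoc τ 1 : Fin (M + 1) → I) := by
  intro i j
  refine Fin.lastCases (fun h => absurd h (Fin.le_last _).not_gt) (fun i => ?_) i
  refine Fin.lastCases (fun _ => ?_) (fun j h => ?_) j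
  · simpa using h1 i
  · simpa using hτ (Fin.castSucc_lt_castSucc_iff.1 h)

theorem strictMono_padUnit {M : ℕ} {τ : Fin M → I} (hτ : StrictMono τ)
    (h01 : ∀ j, τ j ∈ Ioo (0 : I) 1) : StrictMono (padUnit fun j => (τ j : ℝ)) := by
  rw [padUnit, strictMono_cons_iff]
  have h1 : (Fin.snoc (fun j => (τ j : ℝ)) 1 : Fin (M + 1) → ℝ) =
      fun m => (((Fin.snoc τ 1 : Fin (M + 1) → I) m : I) : ℝ) := by
    ext m
    refine Fin.lastCases ?_ (fun i => ?_) m <;> simp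
  rw [h1]
  have h2 := strictMono_snoc_one hτ fun j => (h01 j).2
  intro m
  refine Fin.cases ?_ (fun i => ?_) m
  · rw [incr_zero]
    have : ∀ m, (0 : I) < (Fin.snoc τ 1 : Fin (M + 1) → I) m := by
      intro m
      refine Fin.lastCases ?_ (fun i => ?_) m
      · simp
      · simpa using (h01 i).1
    exact this 0
  · rw [incr_succ, sub_pos]
    exact h2 i.castSucc_lt_succ

/-- The exponents of the Dirichlet density. -/
def dirichletExp (β : ℝ) {M : ℕ} (t : Fin M → ℝ) (m : Fin (M + 1)) : ℝ :=
  β * (padUnit t m.succ - padUnit t m.castSucc)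

theorem sum_dirichletExp (β : ℝ) {M : ℕ} (t : Fin M → ℝ) : ∑ m, dirichletExp β t m = β := by
  simp only [dirichletExp]
  rw [← Finset.mul_sum, Fin.sum_succ_sub_castSucc]
  rw [← Fin.succ_last]
  simp [padUnit]

theorem dirichletDensity_eq (β : ℝ) {M : ℕ} (t x : Fin M → ℝ) :
    dirichletDensity β t x = Real.Gamma β / (∏ i, Real.Gamma (dirichletExp β t i)) *
      coneDensity (dirichletExp β t) (Fin.snoc x 1) := by
  rw [dirichletDensity, coneDensity]
  have h : StrictMono (padUnit x) ↔ (Fin.snoc x 1 : Fin (M + 1) → ℝ) ∈ incrCone M :=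
    strictMono_cons_iff _
  by_cases hx : StrictMono (padUnit x)
  · rw [if_pos hx, if_pos (h.1 hx)]
    rfl
  · rw [if_neg hx, if_neg (mt h.2 hx), mul_zero]

theorem measurable_dirichletDensity (β : ℝ) {M : ℕ} (t : Fin M → ℝ) :
    Measurable (dirichletDensity β t) := by
  simp only [funext fun x => dirichletDensity_eq β t x]
  exact ((measurable_coneDensity _).comp measurable_snoc_one).const_mul _

/-- Evaluation of `g` at finitely many times. -/
def G0.evalAt {M : ℕ} (τ : Fin M → I) (g : G0) : Fin M → ℝ := fun j => g (τ j)

theorem G0.measurable_evalAt {M : ℕ} (τ : Fin M → I) : Measurable (G0.evalAt τ) :=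
  measurable_pi_lambda _ fun j => G0.measurable_apply (τ j)

namespace IsDirichletProcess

variable {β : ℝ} {Q : Measure G0}

theorem map_evalAt (hQ : IsDirichletProcess β Q) {M : ℕ} {τ : Fin M → I} (hτ : StrictMono τ)
    (h01 : ∀ j, τ j ∈ Ioo (0 : I) 1) :
    Q.map (G0.evalAt τ) = volume.withDensity
      fun x => ENNReal.ofReal (dirichletDensity β (fun i => (τ i : ℝ)) x) := by
  ext A hA
  rw [Measure.map_apply (G0.measurable_evalAt τ) hA, withDensity_apply _ hA]
  exact hQ.finiteDim M τ (strictMono_padUnit hτ h01) A hA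

variable {n : ℕ} (w : StepWeight n)

/-- On a grid containing the breakpoints this is the change of variables `lintegral_scaleIncr`. The
constant need not be known, only its independence of `F`: taking `F = 1` determines it. -/
theorem lintegral_reweight_evalAt (hQ : IsDirichletProcess β Q) (hβ : 0 < β) {M : ℕ}
    {τ : Fin M → I} (hτ : StrictMono τ) (h01 : ∀ j, τ j ∈ Ioo (0 : I) 1)
    (hp : ∀ k, w.p k ∈ range τ) :
    ∃ C : ENNReal, ∀ F : (Fin M → ℝ) → ENNReal, Measurable F →
      ∫⁻ g, F (G0.evalAt τ (w.reweight g)) * ENNReal.ofReal (w.mass g ^ (-β)) ∂Q =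
        C * ∫⁻ g, F (G0.evalAt τ g) ∂Q := by
  set τ' : Fin (M + 1) → I := Fin.snoc τ 1
  set r : Fin (M + 1) → ℝ := fun m => stepFun w.p w.c₀ w.c (τ' m)
  set a := dirichletExp β fun i => (τ i : ℝ)
  have hr : ∀ m, 0 < r m := fun m => w.stepFun_pos _
  have ha : ∑ m, a m = β := sum_dirichletExp β _
  have hgrid : ∀ g : G0, (fun m => stepInt w.p w.c₀ w.c g (τ' m)) =
      scaleIncr r (Fin.snoc (G0.evalAt τ g) 1) := by
    intro g
    rw [w.stepInt_grid τ' (strictMono_snoc_one hτ fun j => (h01 j).2)]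
    · congr 1
      ext m
      refine Fin.lastCases ?_ (fun i => ?_) m
      · simp [τ', g.map_one']
      · simp [τ', G0.evalAt]
    · intro k
      obtain ⟨j, hj⟩ := hp k
      exact ⟨j.castSucc, by simp [τ', hj]⟩
  have hmass : ∀ g : G0, w.mass g = scaleIncr r (Fin.snoc (G0.evalAt τ g) 1) (Fin.last M) := by
    intro g
    rw [← hgrid]
    simp [τ', StepWeight.mass]
  have hev : ∀ g : G0, G0.evalAt τ (w.reweight g) =
      normalizeLast (scaleIncr r (Fin.snoc (G0.evalAt τ g) 1)) := by
    intro g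
    ext j
    rw [normalizeLast, ← hmass, ← hgrid]
    simp [τ', G0.evalAt, StepWeight.reweight_apply]
  have hLm : Measurable fun z : Fin M → ℝ => scaleIncr r (Fin.snoc z 1) :=
    (LinearMap.continuous_of_finiteDimensional (scaleIncr r)).measurable.comp measurable_snoc_one
  have hd : Measurable fun x => ENNReal.ofReal (dirichletDensity β (fun i => (τ i : ℝ)) x) :=
    (measurable_dirichletDensity β _).ennreal_ofReal
  refine ⟨ENNReal.ofReal (∏ m, r m ^ (a m))⁻¹, fun F hF => ?_⟩
  have hFm : Measurable fun z : Fin M → ℝ => F (normalizeLast (scaleIncr r (Fin.snoc z 1))) *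
      ENNReal.ofReal (scaleIncr r (Fin.snoc z 1) (Fin.last M) ^ (-β)) :=
    (hF.comp (measurable_normalizeLast.comp hLm)).mul
      (((measurable_pi_apply _).comp hLm).pow_const _).ennreal_ofReal
  have e1 : ∫⁻ g, F (G0.evalAt τ (w.reweight g)) * ENNReal.ofReal (w.mass g ^ (-β)) ∂Q =
      ∫⁻ z, (F (normalizeLast (scaleIncr r (Fin.snoc z 1))) *
        ENNReal.ofReal (scaleIncr r (Fin.snoc z 1) (Fin.last M) ^ (-β))) ∂Q.map (G0.evalAt τ) := by
    rw [lintegral_map hFm (G0.measurable_evalAt τ)]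
    simp only [hmass, hev]
  have e2 : ∫⁻ g, F (G0.evalAt τ g) ∂Q = ∫⁻ z, F z ∂Q.map (G0.evalAt τ) :=
    (lintegral_map hF (G0.measurable_evalAt τ)).symm
  rw [e1, e2, hQ.map_evalAt hτ h01, lintegral_withDensity_eq_lintegral_mul _ hd hFm,
    lintegral_withDensity_eq_lintegral_mul _ hd hF]
  simp only [Pi.mul_apply]
  set Z : ℝ := Real.Gamma β / ∏ i, Real.Gamma (a i)
  have hZ : 0 ≤ Z := by
    refine div_nonneg (Real.Gamma_pos_of_pos hβ).le (Finset.prod_nonneg fun m _ => ?_)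
    have h := (strictMono_padUnit hτ h01) m.castSucc_lt_succ
    exact (Real.Gamma_pos_of_pos (mul_pos hβ (sub_pos.2 h))).le
  have hden : ∀ z, ENNReal.ofReal (dirichletDensity β (fun i => (τ i : ℝ)) z) =
      ENNReal.ofReal Z * ENNReal.ofReal (coneDensity a (Fin.snoc z 1)) := by
    intro z
    rw [dirichletDensity_eq, ENNReal.ofReal_mul hZ]
  have key := lintegral_scaleIncr a r (ha.symm ▸ hβ) hr F hF
  rw [ha] at key
  simp only [hden, mul_assoc (ENNReal.ofReal Z)]
  rw [lintegral_const_mul' _ _ ENNReal.ofReal_ne_top, lintegral_const_mul' _ _ ENNReal.ofReal_ne_top,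
    mul_left_comm]
  congr 1
  rw [show ∫⁻ z : Fin M → ℝ, ENNReal.ofReal (coneDensity a (Fin.snoc z 1)) * F z =
    ∫⁻ z : Fin M → ℝ, F z * ENNReal.ofReal (coneDensity a (Fin.snoc z 1)) from
      lintegral_congr fun z => mul_comm _ _, ← key]
  refine lintegral_congr fun z => ?_
  rw [mul_left_comm, mul_comm (ENNReal.ofReal (coneDensity _ _))]
  -- The base of the power is known to be positive only on the cone; off the cone the density
  -- vanishes.
  by_cases hz : (Fin.snoc z 1 : Fin (M + 1) → ℝ) ∈ incrCone M
  · rw [ENNReal.ofReal_mul (Real.rpow_nonneg (last_pos_of_mem_incrCone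
      ((scaleIncr_mem_incrCone hr).2 hz)).le _)]
  · simp [coneDensity_of_notMem hz]

/-- Quasi-invariance of the Dirichlet process under reweighting. -/
theorem map_reweight_withDensity (hQ : IsDirichletProcess β Q) (hβ : 0 < β) :
    (Q.withDensity fun g => ENNReal.ofReal (w.mass g ^ (-β))).map w.reweight =
      (∫⁻ g, ENNReal.ofReal (w.mass g ^ (-β)) ∂Q) • Q := by
  have := hQ.isProbabilityMeasure
  have hdm : Measurable fun g => ENNReal.ofReal (w.mass g ^ (-β)) :=
    (w.measurable_mass.pow_const _).ennreal_ofReal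
  have hfin : ∫⁻ g, ENNReal.ofReal (w.mass g ^ (-β)) ∂Q ≠ ⊤ := by
    refine ne_top_of_le_ne_top (b := ENNReal.ofReal (w.lo ^ (-β))) ENNReal.ofReal_ne_top ?_
    refine (lintegral_mono fun g => ENNReal.ofReal_le_ofReal
      (Real.rpow_le_rpow_of_nonpos w.lo_pos (w.lo_le_mass g) (neg_nonpos.2 hβ.le))).trans ?_
    simp
  have : IsFiniteMeasure (Q.withDensity fun g => ENNReal.ofReal (w.mass g ^ (-β))) :=
    isFiniteMeasure_withDensity hfin
  have : IsFiniteMeasure ((∫⁻ g, ENNReal.ofReal (w.mass g ^ (-β)) ∂Q) • Q) :=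
    Measure.smul_finite Q hfin
  classical
  refine G0.measure_ext (Finset.univ.image w.p) (fun t ht => ?_) fun M τ hτ h01 hT => ?_
  · obtain ⟨k, _, rfl⟩ := Finset.mem_image.1 ht
    exact w.p_mem k
  obtain ⟨C, hC⟩ := hQ.lintegral_reweight_evalAt w hβ hτ h01
    fun k => hT _ (Finset.mem_image_of_mem _ (Finset.mem_univ k))
  -- Since `Q` has mass `1`, this identifies `C` with the total mass of the weighted measure.
  have h1 := hC (fun _ => 1) measurable_const
  simp only [one_mul, lintegral_one, measure_univ, mul_one] at h1
  rw [h1]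
  change Measure.map (G0.evalAt τ) _ = Measure.map (G0.evalAt τ) _
  ext A hA
  have hA' : MeasurableSet (G0.evalAt τ ⁻¹' A) := G0.measurable_evalAt τ hA
  have h2 := hC (A.indicator 1) (measurable_one.indicator hA)
  rw [Measure.map_apply (G0.measurable_evalAt τ) hA, Measure.map_apply (G0.measurable_evalAt τ) hA,
    Measure.map_apply w.measurable_reweight hA', withDensity_apply _ (w.measurable_reweight hA'),
    ← lintegral_indicator (w.measurable_reweight hA'), Measure.smul_apply, smul_eq_mul,
    ← lintegral_indicator_one hA']
  refine Eq.trans (lintegral_congr fun g => ?_) h2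
  by_cases h : G0.evalAt τ (w.reweight g) ∈ A <;> simp [indicator, h]

/-- The mass lies in `[lo, hi]`, so `1 ≤ hi ^ β * mass ^ (-β)`, and the total weight is at most `lo
^ (-β)`. -/
theorem map_reweight_le (hQ : IsDirichletProcess β Q) (hβ : 0 < β) :
    Q.map w.reweight ≤ ENNReal.ofReal (w.hi ^ β * w.lo ^ (-β)) • Q := by
  have := hQ.isProbabilityMeasure
  refine Measure.le_iff.2 fun s hs => ?_
  have hs' := w.measurable_reweight hs
  have h := congrArg (fun μ => μ s) (hQ.map_reweight_withDensity w hβ)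
  simp only [Measure.smul_apply, smul_eq_mul] at h
  rw [Measure.map_apply w.measurable_reweight hs, withDensity_apply _ hs'] at h
  have hhi : 0 < w.hi := w.lo_pos.trans_le ((w.lo_le 0).trans (w.le_hi 0))
  have hK : ∫⁻ g, ENNReal.ofReal (w.mass g ^ (-β)) ∂Q ≤ ENNReal.ofReal (w.lo ^ (-β)) := by
    refine (lintegral_mono fun g => ENNReal.ofReal_le_ofReal
      (Real.rpow_le_rpow_of_nonpos w.lo_pos (w.lo_le_mass g) (neg_nonpos.2 hβ.le))).trans ?_
    simp
  rw [Measure.map_apply w.measurable_reweight hs, Measure.smul_apply, smul_eq_mul,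
    ENNReal.ofReal_mul (by positivity), mul_assoc]
  calc Q (w.reweight ⁻¹' s) = ∫⁻ _ in w.reweight ⁻¹' s, 1 ∂Q := by simp
    _ ≤ ∫⁻ g in w.reweight ⁻¹' s, ENNReal.ofReal (w.hi ^ β) *
          ENNReal.ofReal (w.mass g ^ (-β)) ∂Q := by
        refine lintegral_mono fun g => ?_
        rw [← ENNReal.ofReal_mul (by positivity), ENNReal.one_le_ofReal]
        refine le_trans (le_of_eq ?_) (mul_le_mul_of_nonneg_left (Real.rpow_le_rpow_of_nonpos
          (w.mass_pos g) (w.mass_le_hi g) (neg_nonpos.2 hβ.le)) (by positivity))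
        rw [← Real.rpow_add hhi]
        simp
    _ = ENNReal.ofReal (w.hi ^ β) *
          ((∫⁻ g, ENNReal.ofReal (w.mass g ^ (-β)) ∂Q) * Q s) := by
        rw [lintegral_const_mul' _ _ ENNReal.ofReal_ne_top, h]
    _ ≤ _ := by gcongr

end IsDirichletProcess

/-! ### `C¹` extensions and the measurability of cylinder functions and their gradients. -/

section ExtendC1

/-- The derivative on `[0,1]`, extended to `ℝ` by constants. -/
def derivExtend (f : ℝ → ℝ) (x : ℝ) : ℝ :=
  derivWithin f (Icc 0 1) (projIcc (0 : ℝ) 1 zero_le_one x)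

/-- The `C¹` extension to `ℝ` of a `C¹` function on `[0,1]`. -/
def extendC1 (f : ℝ → ℝ) (x : ℝ) : ℝ := f 0 + ∫ y in (0 : ℝ)..x, derivExtend f y

variable {f : ℝ → ℝ} (hf : ContDiffOn ℝ 1 f (Icc 0 1))

theorem derivExtend_coe (f : ℝ → ℝ) (x : I) :
    derivExtend f x = derivWithin f (Icc 0 1) x := by
  rw [derivExtend, projIcc_val]

include hf in
theorem continuous_derivExtend : Continuous (derivExtend f) := by
  have h := hf.continuousOn_derivWithin (uniqueDiffOn_Icc zero_lt_one) le_rfl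
  exact (continuousOn_iff_continuous_domRestrict.1 h).comp continuous_projIcc

include hf in
theorem exists_bound_derivExtend : ∃ B, ∀ x, |derivExtend f x| ≤ B := by
  have h := hf.continuousOn_derivWithin (uniqueDiffOn_Icc zero_lt_one) le_rfl
  obtain ⟨B, hB⟩ := isCompact_Icc.exists_bound_of_continuousOn h
  exact ⟨B, fun x => hB _ (projIcc (0 : ℝ) 1 zero_le_one x).2⟩

include hf in
-- The extension is needed because `g t + x * (h t - g t)` is differentiated in `x` over all of `ℝ`,
-- where it may leave `[0,1]`.
theorem hasDerivAt_extendC1 (x : ℝ) : HasDerivAt (extendC1 f) (derivExtend f x) x := by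
  have hc := continuous_derivExtend hf
  exact (intervalIntegral.integral_hasDerivAt_right (hc.intervalIntegrable _ _)
    (hc.stronglyMeasurableAtFilter _ _) hc.continuousAt).const_add _

include hf in
theorem continuous_extendC1 : Continuous (extendC1 f) :=
  continuous_iff_continuousAt.2 fun x => (hasDerivAt_extendC1 hf x).continuousAt

include hf in
theorem extendC1_coe (x : I) : extendC1 f x = f x := by
  rw [extendC1, intervalIntegral.integral_eq_sub_of_hasDerivAt_of_le x.2.1
    (hf.continuousOn.mono (Icc_subset_Icc_right x.2.2)) (fun y hy => ?_)
    ((continuous_derivExtend hf).intervalIntegrable _ _)]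
  · ring
  · have hy' : y ∈ Icc (0 : ℝ) 1 := ⟨hy.1.le, hy.2.le.trans x.2.2⟩
    have hd := ((hf.differentiableOn one_ne_zero) y hy').hasDerivWithinAt
    rw [show derivExtend f y = derivWithin f (Icc 0 1) y from derivExtend_coe f ⟨y, hy'⟩]
    exact hd.hasDerivAt (Icc_mem_nhds hy.1 (hy.2.trans_le x.2.2))

end ExtendC1

namespace ZCylinder

variable (c : ZCylinder)

theorem coords_eq (g : G0) (i : Fin c.m) : c.coords g i = ∫ s : I, extendC1 (c.α i) (g s) := by
  simp only [coords, extendC1_coe (c.contDiffOn_α i)]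

theorem grad_eq (p : G0 × I) : c.grad p = ∑ i, fderiv ℝ c.U (c.coords p.1) (Pi.single i 1) *
    derivExtend (c.α i) (p.1 p.2) := by
  simp only [grad, derivExtend_coe]

theorem measurable_coords : Measurable c.coords := by
  refine measurable_pi_lambda _ fun i => ?_
  simp only [coords_eq]
  have h : Measurable fun p : G0 × I => extendC1 (c.α i) (p.1 p.2) :=
    (continuous_extendC1 (c.contDiffOn_α i)).measurable.comp G0.measurable_uncurry
  exact (h.stronglyMeasurable.integral_prod_right (ν := (volume : Measure I))).measurable

theorem measurable_toFun : Measurable c.toFun :=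
  c.contDiff_U.continuous.measurable.comp c.measurable_coords

theorem measurable_grad : Measurable c.grad := by
  simp only [funext c.grad_eq]
  refine Finset.measurable_fun_sum _ fun i _ => ?_
  refine Measurable.mul ?_
    ((continuous_derivExtend (c.contDiffOn_α i)).measurable.comp G0.measurable_uncurry)
  have h : Continuous fun x => fderiv ℝ c.U x (Pi.single i 1) :=
    (c.contDiff_U.continuous_fderiv one_ne_zero).clm_apply continuous_const
  exact h.measurable.comp (c.measurable_coords.comp measurable_fst)

end ZCylinder

/-! ### Cylinder functions along segments. -/

section Segment

variable {f : ℝ → ℝ} (hf : ContDiffOn ℝ 1 f (Icc 0 1)) (g h : G0)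

theorem G0.abs_sub_le_one (t : I) : |(h t : ℝ) - g t| ≤ 1 :=
  abs_sub_le_iff.2 ⟨by linarith [(h t).2.2, (g t).2.1], by linarith [(g t).2.2, (h t).2.1]⟩

include hf in
theorem integrable_derivExtend_segment (x : ℝ) :
    Integrable fun t : I => derivExtend f (g t + x * (h t - g t)) * (h t - g t) := by
  obtain ⟨B, hB⟩ := exists_bound_derivExtend hf
  have hm : Measurable fun t : I => derivExtend f (g t + x * (h t - g t)) * (h t - g t) :=
    ((continuous_derivExtend hf).measurable.comp (g.measurable_coe.add
      ((h.measurable_coe.sub g.measurable_coe).const_mul x))).mul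
      (h.measurable_coe.sub g.measurable_coe)
  refine Integrable.of_bound hm.aestronglyMeasurable B (Eventually.of_forall fun t => ?_)
  rw [norm_mul, Real.norm_eq_abs, Real.norm_eq_abs]
  exact (mul_le_mul (hB _) (g.abs_sub_le_one h t) (abs_nonneg _)
    ((abs_nonneg _).trans (hB 0))).trans (mul_one B).le

include hf in
-- Differentiation under the integral, dominated by a bound `B` for the extended derivative, since
-- `|h - g| ≤ 1`.
theorem hasDerivAt_integral_segment (x : ℝ) :
    HasDerivAt (fun x : ℝ => ∫ t : I, extendC1 f (g t + x * (h t - g t)))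
      (∫ t : I, derivExtend f (g t + x * (h t - g t)) * (h t - g t)) x := by
  obtain ⟨B, hB⟩ := exists_bound_derivExtend hf
  have hm : ∀ x : ℝ, Measurable fun t : I => (g t + x * (h t - g t) : ℝ) := fun x =>
    g.measurable_coe.add ((h.measurable_coe.sub g.measurable_coe).const_mul x)
  have hmE : ∀ x : ℝ, Measurable fun t : I => extendC1 f (g t + x * (h t - g t)) := fun x =>
    (continuous_extendC1 hf).measurable.comp (hm x)
  refine (hasDerivAt_integral_of_dominated_loc_of_deriv_le (bound := fun _ => B)
    (F' := fun (x : ℝ) (t : I) => derivExtend f (g t + x * (h t - g t)) * (h t - g t))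
    (Metric.ball_mem_nhds x one_pos)
    (Eventually.of_forall fun x => (hmE x).aestronglyMeasurable) ?_
    (integrable_derivExtend_segment hf g h x).aestronglyMeasurable
    (Eventually.of_forall fun t y _ => ?_) (integrable_const B)
    (Eventually.of_forall fun t y _ => ?_)).2
  · obtain ⟨C, hC⟩ := (isCompact_Icc (a := -(1 + |x|)) (b := 1 + |x|)).exists_bound_of_continuousOn
      (continuous_extendC1 hf).continuousOn
    refine Integrable.of_bound (hmE x).aestronglyMeasurable C (Eventually.of_forall fun t => ?_)
    refine hC _ (abs_le.1 ((abs_add_le _ _).trans (add_le_add ?_ ?_)))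
    · rw [abs_of_nonneg (g t).2.1]
      exact (g t).2.2
    · rw [abs_mul]
      exact mul_le_of_le_one_right (abs_nonneg x) (g.abs_sub_le_one h t)
  · rw [norm_mul, Real.norm_eq_abs, Real.norm_eq_abs]
    refine (mul_le_mul (hB _) (g.abs_sub_le_one h t) (abs_nonneg _)
      ((abs_nonneg _).trans (hB 0))).trans (mul_one B).le
  · have h1 : HasDerivAt (fun y : ℝ => (g t : ℝ) + y * (h t - g t)) ((h t : ℝ) - g t) y := by
      simpa using ((hasDerivAt_id y).mul_const ((h t : ℝ) - g t)).const_add (g t : ℝ)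
    exact (hasDerivAt_extendC1 hf _).comp y h1

include hf in
theorem continuous_integral_segment :
    Continuous fun x : ℝ => ∫ t : I, derivExtend f (g t + x * (h t - g t)) * (h t - g t) := by
  obtain ⟨B, hB⟩ := exists_bound_derivExtend hf
  refine continuous_of_dominated (bound := fun _ => B) (fun x => ?_)
    (fun x => Eventually.of_forall fun t => ?_) (integrable_const B)
    (Eventually.of_forall fun t => ?_)
  · exact (integrable_derivExtend_segment hf g h x).aestronglyMeasurable
  · rw [norm_mul, Real.norm_eq_abs, Real.norm_eq_abs]
    exact (mul_le_mul (hB _) (g.abs_sub_le_one h t) (abs_nonneg _)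
      ((abs_nonneg _).trans (hB 0))).trans (mul_one B).le
  · exact ((continuous_derivExtend hf).comp
      (continuous_const.add (continuous_id.mul continuous_const))).mul continuous_const

/-- The fundamental theorem of calculus for a cylinder function along a reparametrized segment. -/
theorem ZCylinder.toFun_sub_toFun (c : ZCylinder) (θ θ' : ℝ → ℝ)
    (hθ : ∀ s ∈ Icc (0 : ℝ) 1, HasDerivAt θ (θ' s) s) (hθ' : ContinuousOn θ' (Icc 0 1))
    (k : I → G0) (hk : ∀ s t, (k s t : ℝ) = g t + θ s * (h t - g t)) :
    c.toFun (k 1) - c.toFun (k 0) =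
      ∫ s : I, θ' s * ∫ t : I, c.grad (k s, t) * (h t - g t) := by
  set A : ℝ → Fin c.m → ℝ := fun x i => ∫ t : I, extendC1 (c.α i) (g t + x * (h t - g t))
  set D : ℝ → Fin c.m → ℝ := fun x i =>
    ∫ t : I, derivExtend (c.α i) (g t + x * (h t - g t)) * (h t - g t)
  have hAD : ∀ x, HasDerivAt A (D x) x := fun x => hasDerivAt_pi.2 fun i =>
    hasDerivAt_integral_segment (c.contDiffOn_α i) g h x
  have hDc : Continuous D := continuous_pi fun i =>
    continuous_integral_segment (c.contDiffOn_α i) g h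
  have hAc : Continuous A := continuous_iff_continuousAt.2 fun x => (hAD x).continuousAt
  have hcoords : ∀ s : I, c.coords (k s) = A (θ s) := by
    intro s
    ext i
    simp only [ZCylinder.coords_eq, hk, A]
  set F : ℝ → ℝ := fun s => fderiv ℝ c.U (A (θ s)) (θ' s • D (θ s))
  have hder : ∀ s ∈ uIcc (0 : ℝ) 1, HasDerivAt (fun s => c.U (A (θ s))) (F s) s := by
    intro s hs
    rw [uIcc_of_le zero_le_one] at hs
    have h1 : HasDerivAt (fun s => A (θ s)) (θ' s • D (θ s)) s :=
      (hAD (θ s)).scomp s (hθ s hs)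
    exact ((c.contDiff_U.differentiable one_ne_zero _).hasFDerivAt).comp_hasDerivAt s h1
  have hθc : ContinuousOn θ (Icc 0 1) := fun s hs => (hθ s hs).continuousAt.continuousWithinAt
  have hFc : ContinuousOn F (uIcc 0 1) := by
    rw [uIcc_of_le zero_le_one]
    exact (((c.contDiff_U.continuous_fderiv one_ne_zero).comp hAc).comp_continuousOn hθc).clm_apply
      (hθ'.smul (hDc.comp_continuousOn hθc))
  have hftc := intervalIntegral.integral_eq_sub_of_hasDerivAt hder hFc.intervalIntegrable
  have hF : ∀ s : I, F s = θ' s * ∫ t : I, c.grad (k s, t) * (h t - g t) := by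
    intro s
    have hgr : ∀ t, c.grad (k s, t) * (h t - g t) =
        ∑ i, fderiv ℝ c.U (A (θ s)) (Pi.single i 1) *
          (derivExtend (c.α i) (g t + θ s * (h t - g t)) * (h t - g t)) := by
      intro t
      rw [ZCylinder.grad_eq, Finset.sum_mul]
      simp only [hcoords, hk, mul_assoc]
    simp only [F, hgr, map_smul, smul_eq_mul]
    congr 1
    rw [integral_finsetSum]
    · simp only [integral_const_mul]
      -- Expanding in the standard basis turns the total derivative of `U` into its partial
      -- derivatives.
      conv_lhs => rw [pi_eq_sum_univ (D (θ s)), map_sum]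
      refine Finset.sum_congr rfl fun i _ => ?_
      rw [map_smul, smul_eq_mul, mul_comm]
      congr 2
      ext j
      simp [Pi.single_apply, eq_comm]
    · intro i _
      exact (integrable_derivExtend_segment (c.contDiffOn_α i) g h (θ s)).const_mul _
  have h1 : c.toFun (k 1) = c.U (A (θ 1)) := by
    rw [ZCylinder.toFun, hcoords, Icc.coe_one]
  have h0 : c.toFun (k 0) = c.U (A (θ 0)) := by
    rw [ZCylinder.toFun, hcoords, Icc.coe_zero]
  rw [h1, h0, ← hftc, intervalIntegral.integral_of_le zero_le_one, ← integral_Icc_eq_integral_Ioc,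
    ← integral_subtype_comap measurableSet_Icc]
  exact integral_congr_ae (Eventually.of_forall hF)

end Segment

namespace G0

theorem ext_coe {g h : G0} (H : ∀ t, (g t : ℝ) = h t) : g = h := by
  cases g
  cases h
  congr
  exact funext fun t => Subtype.ext (H t)

theorem edist_eq_eLpNorm (g h : G0) :
    edist g h = eLpNorm (fun t : I => (g t : ℝ) - h t) 2 volume :=
  Lp.edist_toLp_toLp _ _ g.memLp h.memLp

end G0

/-! ### The path of reweightings from the identity to a given one. -/

namespace StepWeight

variable {n : ℕ} (w : StepWeight n)

theorem stepFun_mix (s : ℝ) (t : I) :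
    stepFun w.p (1 - s + s * w.c₀) (fun k => s * w.c k) t =
      (1 - s) + s * stepFun w.p w.c₀ w.c t := by
  simp only [stepFun, mul_add, Finset.mul_sum, mul_ite, mul_zero]
  ring

/-- The step function `1 - s + s f`. -/
def mix (s : I) : StepWeight n where
  p := w.p
  c₀ := 1 - s + s * w.c₀
  c k := s * w.c k
  lo := min 1 w.lo
  hi := max 1 w.hi
  p_mem := w.p_mem
  lo_pos := lt_min one_pos w.lo_pos
  lo_le t := by
    rw [stepFun_mix]
    have h1 := mul_le_mul_of_nonneg_left ((min_le_right 1 w.lo).trans (w.lo_le t)) s.2.1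
    have h2 := mul_le_mul_of_nonneg_left (min_le_left 1 w.lo) (sub_nonneg.2 s.2.2)
    linarith
  le_hi t := by
    rw [stepFun_mix]
    have h1 := mul_le_mul_of_nonneg_left ((w.le_hi t).trans (le_max_right 1 w.hi)) s.2.1
    have h2 := mul_le_mul_of_nonneg_left (le_max_left 1 w.hi) (sub_nonneg.2 s.2.2)
    linarith

theorem stepInt_mix (s : I) (g : G0) (t : I) :
    stepInt (w.mix s).p (w.mix s).c₀ (w.mix s).c g t =
      (1 - s) * g t + s * stepInt w.p w.c₀ w.c g t := by
  simp only [mix, stepInt, mul_add, Finset.mul_sum, mul_assoc]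
  ring

theorem mass_mix (s : I) (g : G0) : (w.mix s).mass g = 1 - s + s * w.mass g := by
  rw [mass, stepInt_mix, g.map_one', Icc.coe_one, mul_one, mass]

/-- The position of `(w.mix s).reweight g` on the segment from `g` to `w.reweight g`. -/
def segmentParam (g : G0) (s : ℝ) : ℝ := s * w.mass g / (1 - s + s * w.mass g)

/-- The derivative of `segmentParam`. -/
def segmentSpeed (g : G0) (s : ℝ) : ℝ := w.mass g / (1 - s + s * w.mass g) ^ 2

theorem min_le_mix_mass (g : G0) {s : ℝ} (hs : s ∈ Icc (0 : ℝ) 1) :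
    min 1 w.lo ≤ 1 - s + s * w.mass g := by
  have h := (w.mix ⟨s, hs⟩).lo_le_mass g
  rwa [mass_mix] at h

theorem mix_mass_pos (g : G0) {s : ℝ} (hs : s ∈ Icc (0 : ℝ) 1) : 0 < 1 - s + s * w.mass g :=
  (lt_min one_pos w.lo_pos).trans_le (w.min_le_mix_mass g hs)

/-- Both the integral and its total mass are affine in the weight. The quotient is therefore a
convex combination of `g` and `w.reweight g` whose coefficient does not depend on `t`. -/
theorem reweight_mix_apply (s : I) (g : G0) (t : I) :
    ((w.mix s).reweight g t : ℝ) = g t + w.segmentParam g s * (w.reweight g t - g t) := by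
  have h := (w.mix_mass_pos g s.2).ne'
  have h' := (w.mass_pos g).ne'
  rw [reweight_apply, reweight_apply, stepInt_mix, mass_mix, segmentParam]
  field_simp
  ring

theorem segmentParam_zero (g : G0) : w.segmentParam g 0 = 0 := by simp [segmentParam]

theorem segmentParam_one (g : G0) : w.segmentParam g 1 = 1 := by
  simp [segmentParam, (w.mass_pos g).ne']

theorem reweight_mix_zero (g : G0) : (w.mix 0).reweight g = g :=
  G0.ext_coe fun t => by rw [reweight_mix_apply, Icc.coe_zero, segmentParam_zero]; ring

theorem reweight_mix_one (g : G0) : (w.mix 1).reweight g = w.reweight g :=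
  G0.ext_coe fun t => by rw [reweight_mix_apply, Icc.coe_one, segmentParam_one]; ring

theorem hasDerivAt_segmentParam (g : G0) {s : ℝ} (hs : s ∈ Icc (0 : ℝ) 1) :
    HasDerivAt (w.segmentParam g) (w.segmentSpeed g s) s := by
  have h1 : HasDerivAt (fun s : ℝ => s * w.mass g) (w.mass g) s := by
    simpa using (hasDerivAt_id s).mul_const (w.mass g)
  have h2 : HasDerivAt (fun s : ℝ => 1 - s + s * w.mass g) (-1 + w.mass g) s :=
    ((hasDerivAt_id s).const_sub 1).add h1
  have h3 : HasDerivAt (w.segmentParam g) _ s := h1.div h2 (w.mix_mass_pos g hs).ne'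
  refine h3.congr_deriv ?_
  rw [segmentSpeed]
  congr 1
  ring

theorem continuousOn_segmentSpeed (g : G0) : ContinuousOn (w.segmentSpeed g) (Icc 0 1) := by
  unfold segmentSpeed
  refine continuousOn_const.div (Continuous.continuousOn (by fun_prop)) fun s hs => ?_
  exact pow_ne_zero 2 (w.mix_mass_pos g hs).ne'

theorem segmentSpeed_nonneg (g : G0) (s : ℝ) : 0 ≤ w.segmentSpeed g s :=
  div_nonneg (w.mass_pos g).le (sq_nonneg _)

theorem segmentSpeed_le (g : G0) (s : I) : w.segmentSpeed g s ≤ w.hi / min 1 w.lo ^ 2 := by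
  have h0 : 0 < min 1 w.lo := lt_min one_pos w.lo_pos
  exact div_le_div₀ ((w.mass_pos g).le.trans (w.mass_le_hi g)) (w.mass_le_hi g) (pow_pos h0 2)
    (pow_le_pow_left₀ h0.le (w.min_le_mix_mass g s.2) 2)

/-- The parameter goes from `0` to `1` with nonnegative speed, so the path runs through the segment
exactly once; this gives the sharp constant `1` in the Lipschitz bound. -/
theorem lintegral_segmentSpeed (g : G0) :
    ∫⁻ s : I, ENNReal.ofReal (w.segmentSpeed g s) = 1 := by
  have hc : ContinuousOn (w.segmentSpeed g) (uIcc 0 1) := by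
    rw [uIcc_of_le zero_le_one]
    exact w.continuousOn_segmentSpeed g
  have h := intervalIntegral.integral_eq_sub_of_hasDerivAt
    (fun s hs => w.hasDerivAt_segmentParam g (uIcc_of_le (zero_le_one' ℝ) ▸ hs))
    hc.intervalIntegrable
  rw [intervalIntegral.integral_of_le zero_le_one, ← integral_Icc_eq_integral_Ioc,
    ← integral_subtype_comap measurableSet_Icc, segmentParam_one, segmentParam_zero, sub_zero] at h
  have hcI : Continuous fun s : I => w.segmentSpeed g s :=
    continuousOn_iff_continuous_domRestrict.1 (w.continuousOn_segmentSpeed g)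
  rw [← ofReal_integral_eq_lintegral_ofReal (hcI.integrable_of_hasCompactSupport
    (HasCompactSupport.of_compactSpace _)) (Eventually.of_forall fun s => w.segmentSpeed_nonneg g s)]
  exact (congrArg ENNReal.ofReal h).trans ENNReal.ofReal_one

theorem measurable_reweight_mix : Measurable fun q : G0 × I => (w.mix q.2).reweight q.1 := by
  refine G0.measurable_of_Ioo fun t _ => ?_
  simp only [reweight_apply, stepInt_mix, mass_mix]
  have h2 : Measurable fun q : G0 × I => (q.2 : ℝ) := measurable_subtype_coe.comp measurable_snd
  have h3 : Measurable fun q : G0 × I => (q.1 t : ℝ) := (G0.measurable_apply t).comp measurable_fst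
  have h4 : Measurable fun q : G0 × I => stepInt w.p w.c₀ w.c q.1 t :=
    (measurable_stepInt t).comp measurable_fst
  have h5 : Measurable fun q : G0 × I => w.mass q.1 := w.measurable_mass.comp measurable_fst
  exact (((measurable_const.sub h2).mul h3).add (h2.mul h4)).div
    ((measurable_const.sub h2).add (h2.mul h5))

/-- The increment of a cylinder function under reweighting, in terms of its gradient along the
segment. -/
theorem enorm_cylinder_sub_le (c : ZCylinder) (g : G0) :
    ‖c.toFun (w.reweight g) - c.toFun g‖ₑ ≤ ∫⁻ s : I, ENNReal.ofReal (w.segmentSpeed g s) *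
      ∫⁻ t : I, ‖c.grad ((w.mix s).reweight g, t)‖ₑ * ‖(w.reweight g t : ℝ) - g t‖ₑ := by
  have h := c.toFun_sub_toFun g (w.reweight g) (w.segmentParam g) (w.segmentSpeed g)
    (fun s hs => w.hasDerivAt_segmentParam g hs) (w.continuousOn_segmentSpeed g)
    (fun s => (w.mix s).reweight g) (fun s t => w.reweight_mix_apply s g t)
  rw [reweight_mix_zero, reweight_mix_one] at h
  rw [h]
  refine (enorm_integral_le_lintegral_enorm _).trans (lintegral_mono fun s => ?_)
  rw [enorm_mul, Real.enorm_of_nonneg (w.segmentSpeed_nonneg g s)]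
  gcongr
  refine (enorm_integral_le_lintegral_enorm _).trans (lintegral_mono fun t => ?_)
  rw [enorm_mul]

end StepWeight

/-! ### The almost everywhere Lipschitz bound under reweighting. -/

theorem lintegral_enorm_mul_le_eLpNorm_two {α : Type*} [MeasurableSpace α] {μ : Measure α}
    {f g : α → ℝ} (hf : AEStronglyMeasurable f μ) (hg : AEStronglyMeasurable g μ) :
    ∫⁻ x, ‖f x‖ₑ * ‖g x‖ₑ ∂μ ≤ eLpNorm f 2 μ * eLpNorm g 2 μ := by
  have h := eLpNorm_smul_le_mul_eLpNorm (p := 2) (q := 2) (r := 1) hg hf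
  rw [eLpNorm_one_eq_lintegral_enorm] at h
  simpa [enorm_mul] using h

theorem eLpNorm_section_le_one {V : G0 × I → ℝ} {g : G0}
    (hV : MemLp (fun t => V (g, t)) 2 volume) (h : squareField V V g ≤ 1) :
    eLpNorm (fun t => V (g, t)) 2 volume ≤ 1 := by
  rw [hV.eLpNorm_eq_integral_rpow_norm (by norm_num) (by norm_num), ENNReal.ofReal_le_one]
  have h1 : (∫ t : I, ‖V (g, t)‖ ^ (2 : ENNReal).toReal) = squareField V V g := by
    simp only [squareField]
    refine integral_congr_ae (Eventually.of_forall fun t => ?_)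
    simp only [ENNReal.toReal_ofNat, Real.rpow_two, Real.norm_eq_abs, sq_abs]
    ring
  rw [h1]
  exact Real.rpow_le_one (integral_nonneg fun t => mul_self_nonneg _) h (by norm_num)

namespace IsDirichletProcess

variable {β : ℝ} {Q : Measure G0} {n : ℕ} (w : StepWeight n)

theorem lintegral_comp_reweight_le (hQ : IsDirichletProcess β Q) (hβ : 0 < β) {F : G0 → ENNReal}
    (hF : Measurable F) : ∫⁻ g, F (w.reweight g) ∂Q ≤
      ENNReal.ofReal (w.hi ^ β * w.lo ^ (-β)) * ∫⁻ g, F g ∂Q := by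
  rw [← lintegral_map hF w.measurable_reweight, ← smul_eq_mul, ← lintegral_smul_measure]
  exact lintegral_mono' (hQ.map_reweight_le w hβ) le_rfl

/-- A bound on the excess of `|u (T g) - u g|` over `‖T g - g‖`, by the distance of `(u, V)` from
`(c, 𝔻 c)` for a cylinder function `c`. -/
theorem lintegral_excess_le (hQ : IsDirichletProcess β Q) (hβ : 0 < β) {u : G0 → ℝ}
    (hu : Measurable u) {V : G0 × I → ℝ} (hV : Measurable V)
    (hV1 : ∀ᵐ g ∂Q, eLpNorm (fun t => V (g, t)) 2 volume ≤ 1) (c : ZCylinder) :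
    ∫⁻ g, (‖u (w.reweight g) - u g‖ₑ - edist (w.reweight g) g) ∂Q ≤
      (ENNReal.ofReal (w.hi ^ β * w.lo ^ (-β)) + 1) * ∫⁻ g, ‖c.toFun g - u g‖ₑ ∂Q +
      ENNReal.ofReal (w.hi / min 1 w.lo ^ 2) *
        ENNReal.ofReal (max 1 w.hi ^ β * min 1 w.lo ^ (-β)) *
        ∫⁻ p, ‖c.grad p - V p‖ₑ ∂(Q.prod volume) := by
  have := hQ.isProbabilityMeasure
  set e : G0 → ENNReal := fun g => ‖c.toFun g - u g‖ₑ
  have he : Measurable e := (c.measurable_toFun.sub hu).enorm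
  set B : G0 → ENNReal := fun g => ∫⁻ t : I, ‖c.grad (g, t) - V (g, t)‖ₑ
  have hGV : Measurable fun p => ‖c.grad p - V p‖ₑ := (c.measurable_grad.sub hV).enorm
  have hB : Measurable B := hGV.lintegral_prod_right'
  set C := ENNReal.ofReal (w.hi / min 1 w.lo ^ 2)
  have hVn : Measurable fun g => eLpNorm (fun t => V (g, t)) 2 volume := by
    simp only [eLpNorm_eq_lintegral_rpow_enorm_toReal (p := 2) two_ne_zero ENNReal.ofNat_ne_top]
    exact ((hV.enorm.pow_const _).lintegral_prod_right').pow_const _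
  -- For each `s` the law of the path at time `s` is absolutely continuous with respect to `Q`, so
  -- the gradient bound survives there; Fubini exchanges the order of the quantifiers.
  have hgood : ∀ᵐ g ∂Q, ∀ᵐ s : I,
      eLpNorm (fun t => V ((w.mix s).reweight g, t)) 2 volume ≤ 1 := by
    rw [Measure.ae_ae_comm (p := fun g s =>
      eLpNorm (fun t => V ((w.mix s).reweight g, t)) 2 volume ≤ 1)
      (measurableSet_le (hVn.comp w.measurable_reweight_mix) measurable_const)]
    refine Eventually.of_forall fun s => ?_
    have hac : Q.map (w.mix s).reweight ≪ Q :=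
      (Measure.absolutelyContinuous_of_le (hQ.map_reweight_le (w.mix s) hβ)).trans
        Measure.smul_absolutelyContinuous
    exact ae_of_ae_map (w.mix s).measurable_reweight.aemeasurable (hac.ae_le hV1)
  -- The errors made by replacing `u` and `V` are kept apart: the first occurs at the end points,
  -- the second, `B`, along the whole path.
  have hpt : ∀ᵐ g ∂Q, ‖u (w.reweight g) - u g‖ₑ - edist (w.reweight g) g ≤
      e (w.reweight g) + e g + C * ∫⁻ s : I, B ((w.mix s).reweight g) := by
    filter_upwards [hgood] with g hg
    have hd : AEStronglyMeasurable (fun t : I => (w.reweight g t : ℝ) - g t) volume :=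
      ((w.reweight g).measurable_coe.sub g.measurable_coe).aestronglyMeasurable
    have hcyl : ‖c.toFun (w.reweight g) - c.toFun g‖ₑ ≤
        edist (w.reweight g) g + C * ∫⁻ s : I, B ((w.mix s).reweight g) := by
      have hBs : Measurable fun s : I => B ((w.mix s).reweight g) :=
        hB.comp (w.measurable_reweight_mix.comp measurable_prodMk_left)
      have hsp : Measurable fun s : I => ENNReal.ofReal (w.segmentSpeed g s) :=
        (continuousOn_iff_continuous_domRestrict.1
          (w.continuousOn_segmentSpeed g)).measurable.ennreal_ofReal
      calc _ ≤ _ := w.enorm_cylinder_sub_le c g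
        _ ≤ ∫⁻ s : I, (ENNReal.ofReal (w.segmentSpeed g s) * edist (w.reweight g) g +
              C * B ((w.mix s).reweight g)) := by
            refine lintegral_mono_ae ?_
            filter_upwards [hg] with s hs
            set k := (w.mix s).reweight g
            have hVk : Measurable fun t => V (k, t) := hV.comp measurable_prodMk_left
            have h1 : ∫⁻ t : I, ‖c.grad (k, t)‖ₑ * ‖(w.reweight g t : ℝ) - g t‖ₑ ≤
                edist (w.reweight g) g + B k := by
              calc _ ≤ ∫⁻ t : I, (‖V (k, t)‖ₑ * ‖(w.reweight g t : ℝ) - g t‖ₑ +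
                    ‖c.grad (k, t) - V (k, t)‖ₑ) := by
                    refine lintegral_mono fun t => ?_
                    have h2 : ‖c.grad (k, t)‖ₑ ≤ ‖V (k, t)‖ₑ + ‖c.grad (k, t) - V (k, t)‖ₑ := by
                      refine le_trans (le_of_eq ?_) (enorm_add_le _ _)
                      rw [add_sub_cancel]
                    -- For the error term this crude bound suffices; Cauchy–Schwarz with the exact
                    -- distance is applied to the `V` term alone.
                    have h3 : ‖(w.reweight g t : ℝ) - g t‖ₑ ≤ 1 := by
                      rw [← enorm_one (G := ℝ), enorm_le_iff_norm_le, Real.norm_eq_abs, norm_one]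
                      exact g.abs_sub_le_one _ t
                    refine (mul_le_mul_left h2 _).trans ?_
                    rw [add_mul]
                    gcongr
                    exact mul_le_of_le_one_right' h3
                _ = (∫⁻ t : I, ‖V (k, t)‖ₑ * ‖(w.reweight g t : ℝ) - g t‖ₑ) + B k :=
                    lintegral_add_right _ (hGV.comp measurable_prodMk_left)
                _ ≤ _ := by
                    gcongr
                    refine (lintegral_enorm_mul_le_eLpNorm_two hVk.aestronglyMeasurable hd).trans ?_
                    rw [G0.edist_eq_eLpNorm]
                    exact mul_le_of_le_one_left' hs
            calc _ ≤ ENNReal.ofReal (w.segmentSpeed g s) * (edist (w.reweight g) g + B k) := by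
                  gcongr
              _ ≤ _ := by
                  rw [mul_add]
                  gcongr
                  exact ENNReal.ofReal_le_ofReal (w.segmentSpeed_le g s)
        _ = _ := by
            rw [lintegral_add_right _ (hBs.const_mul C), lintegral_mul_const _ hsp,
              w.lintegral_segmentSpeed, one_mul, lintegral_const_mul _ hBs]
    rw [tsub_le_iff_right]
    calc ‖u (w.reweight g) - u g‖ₑ
        = ‖-(c.toFun (w.reweight g) - u (w.reweight g)) + (c.toFun g - u g) +
            (c.toFun (w.reweight g) - c.toFun g)‖ₑ := by congr 1; ring
      _ ≤ e (w.reweight g) + e g + ‖c.toFun (w.reweight g) - c.toFun g‖ₑ := by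
          refine (enorm_add_le _ _).trans ?_
          gcongr
          refine (enorm_add_le _ _).trans ?_
          rw [enorm_neg]
      _ ≤ e (w.reweight g) + e g +
            (edist (w.reweight g) g + C * ∫⁻ s : I, B ((w.mix s).reweight g)) := by gcongr
      _ = _ := by ring
  have hBm : Measurable fun q : G0 × I => B ((w.mix q.2).reweight q.1) :=
    hB.comp w.measurable_reweight_mix
  refine (lintegral_mono_ae hpt).trans ?_
  have hem : Measurable fun g => e (w.reweight g) + e g := (he.comp w.measurable_reweight).add he
  rw [lintegral_add_left hem,
    lintegral_add_right _ he, lintegral_const_mul _ hBm.lintegral_prod_right', add_mul, one_mul,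
    mul_assoc]
  gcongr
  · exact hQ.lintegral_comp_reweight_le w hβ he
  -- The bounds `min 1 lo` and `max 1 hi` of `w.mix s` do not depend on `s`, so one constant serves
  -- all times.
  · rw [lintegral_lintegral_swap hBm.aemeasurable, lintegral_prod _ hGV.aemeasurable]
    refine (lintegral_mono fun s => hQ.lintegral_comp_reweight_le (w.mix s) hβ hB).trans ?_
    simp [StepWeight.mix, B]

/-- The integrated excess is bounded by constants, depending only on the weight and `β`, times the
distances from `u` and its gradient to those of `c n`, which tend to `0`. -/
theorem ae_enorm_sub_le (hQ : IsDirichletProcess β Q) (hβ : 0 < β) {u : G0 → ℝ}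
    (hu : Continuous u) {Du : G0 × I → ℝ} (hDu : IsClosedGradient Q u Du)
    (hΓ : ∀ᵐ g ∂Q, squareField Du Du g ≤ 1) :
    ∀ᵐ g ∂Q, ‖u (w.reweight g) - u g‖ₑ ≤ edist (w.reweight g) g := by
  have := hQ.isProbabilityMeasure
  obtain ⟨-, hDu2, c, hc1, hc2⟩ := hDu
  -- A Borel version of the gradient, so that it can be composed with the reweighting path.
  set V := hDu2.1.mk Du
  have hV : Measurable V := hDu2.1.stronglyMeasurable_mk.measurable
  have hVe : Du =ᵐ[Q.prod volume] V := hDu2.1.ae_eq_mk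
  have hV2 : MemLp V 2 (Q.prod volume) := hDu2.ae_eq hVe
  have hVe' := Measure.ae_ae_of_ae_prod hVe
  have hVi : ∀ᵐ g ∂Q, Integrable (fun t => V (g, t) ^ 2) volume :=
    hV2.integrable_sq.prod_right_ae
  have hV1 : ∀ᵐ g ∂Q, eLpNorm (fun t => V (g, t)) 2 volume ≤ 1 := by
    filter_upwards [hVe', hVi, hΓ] with g h1 h2 h3
    refine eLpNorm_section_le_one ((memLp_two_iff_integrable_sq
      (hV.comp measurable_prodMk_left).aestronglyMeasurable).2 h2) ?_
    refine le_trans (le_of_eq ?_) h3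
    exact integral_congr_ae (h1.mono fun t ht => by simp only [ht])
  have hum := hu.measurable
  set C₁ := ENNReal.ofReal (w.hi ^ β * w.lo ^ (-β)) + 1
  set C₂ := ENNReal.ofReal (w.hi / min 1 w.lo ^ 2) *
    ENNReal.ofReal (max 1 w.hi ^ β * min 1 w.lo ^ (-β))
  have hlim : Tendsto (fun n => C₁ * eLpNorm (fun g => (c n).toFun g - u g) 2 Q +
      C₂ * eLpNorm (fun p => (c n).grad p - Du p) 2 (Q.prod volume)) atTop (𝓝 0) := by
    have h1 := ENNReal.Tendsto.const_mul (a := C₁) hc1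
      (Or.inr (ENNReal.add_ne_top.2 ⟨ENNReal.ofReal_ne_top, ENNReal.one_ne_top⟩))
    have h2 := ENNReal.Tendsto.const_mul (a := C₂) hc2
      (Or.inr (ENNReal.mul_ne_top ENNReal.ofReal_ne_top ENNReal.ofReal_ne_top))
    simpa using h1.add h2
  have hle : ∀ n, ∫⁻ g, (‖u (w.reweight g) - u g‖ₑ - edist (w.reweight g) g) ∂Q ≤
      C₁ * eLpNorm (fun g => (c n).toFun g - u g) 2 Q +
        C₂ * eLpNorm (fun p => (c n).grad p - Du p) 2 (Q.prod volume) := by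
    intro n
    refine (hQ.lintegral_excess_le w hβ hum hV hV1 (c n)).trans ?_
    have h1 : ∫⁻ g, ‖(c n).toFun g - u g‖ₑ ∂Q ≤ eLpNorm (fun g => (c n).toFun g - u g) 2 Q := by
      rw [← eLpNorm_one_eq_lintegral_enorm]
      exact eLpNorm_le_eLpNorm_of_exponent_le one_le_two
        ((c n).measurable_toFun.sub hum).aestronglyMeasurable
    have h2 : ∫⁻ p, ‖(c n).grad p - V p‖ₑ ∂(Q.prod volume) ≤
        eLpNorm (fun p => (c n).grad p - Du p) 2 (Q.prod volume) := by
      rw [← eLpNorm_one_eq_lintegral_enorm, eLpNorm_congr_ae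
        (show (fun p => (c n).grad p - Du p) =ᵐ[Q.prod volume] fun p => (c n).grad p - V p from
          hVe.mono fun p hp => by simp only [hp])]
      exact eLpNorm_le_eLpNorm_of_exponent_le one_le_two
        ((c n).measurable_grad.sub hV).aestronglyMeasurable
    gcongr
  have hzero : ∫⁻ g, (‖u (w.reweight g) - u g‖ₑ - edist (w.reweight g) g) ∂Q = 0 :=
    le_antisymm (ge_of_tendsto' hlim hle) zero_le
  have hm : Measurable fun g => ‖u (w.reweight g) - u g‖ₑ - edist (w.reweight g) g :=
    ((hum.comp w.measurable_reweight).sub hum).enorm.sub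
      (w.measurable_reweight.edist measurable_id)
  rw [lintegral_eq_zero_iff hm] at hzero
  filter_upwards [hzero] with g hg
  exact tsub_eq_zero_iff_le.1 hg

end IsDirichletProcess

/-! ### Weights with prescribed values and the support of the marginals. -/

section StepFunOfValues

variable {n : ℕ} (r : Fin (n + 1) → ℝ)

/-- The jump coefficients telescope: at `t` they sum, together with the last value, to the value of
`r` on the block containing `t`. -/
theorem stepFun_mem_range {p : Fin n → I} (hp : Monotone p) (t : I) :
    stepFun p (r (Fin.last n)) (fun k => r k.castSucc - r k.succ) t ∈ range r := by
  induction n with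
  | zero => exact ⟨0, by simp [stepFun]⟩
  | succ n ih =>
    by_cases h : t ≤ p 0
    · refine ⟨0, ?_⟩
      have h' : ∀ k, t ≤ p k := fun k => h.trans (hp (Fin.zero_le k))
      have hs := Fin.sum_succ_sub_castSucc r
      simp only [stepFun, h', if_true]
      rw [← neg_inj, neg_add, ← Finset.sum_neg_distrib]
      simp only [neg_sub]
      rw [hs]
      ring
    · obtain ⟨m, hm⟩ := ih (fun m => r m.succ) (p := fun k => p k.succ)
        (hp.comp (Fin.strictMono_succ).monotone)
      refine ⟨m.succ, hm.trans ?_⟩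
      simp only [stepFun, Fin.sum_univ_succ (n := n), h, if_false, zero_add, Fin.succ_last,
        Fin.succ_castSucc]

theorem stepFun_apply_self {p : Fin n → I} (hp : StrictMono p) (j : Fin n) :
    stepFun p (r (Fin.last n)) (fun k => r k.castSucc - r k.succ) (p j) = r j.castSucc := by
  induction n with
  | zero => exact j.elim0
  | succ n ih =>
    refine Fin.cases ?_ (fun i => ?_) j
    · have h' : ∀ k, p 0 ≤ p k := fun k => hp.monotone (Fin.zero_le k)
      have hs := Fin.sum_succ_sub_castSucc r
      simp only [stepFun, h', if_true]
      rw [← neg_inj, neg_add, ← Finset.sum_neg_distrib]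
      simp only [neg_sub]
      rw [hs]
      simp only [Fin.castSucc_zero]
      ring
    · have h := ih (fun m => r m.succ) (p := fun k => p k.succ) (hp.comp Fin.strictMono_succ) i
      have h0 : ¬ p i.succ ≤ p 0 := (hp (Fin.succ_pos i)).not_ge
      rw [Fin.succ_castSucc] at h
      rw [← h]
      simp only [stepFun, Fin.sum_univ_succ (n := n), h0, if_false, zero_add, Fin.succ_last,
        Fin.succ_castSucc]

/-- The step function with the positive values `r` on the blocks of the partition `p`. -/
def StepWeight.ofValues (p : Fin n → I) (hp : StrictMono p) (h01 : ∀ k, p k ∈ Ioo (0 : I) 1)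
    (hr : ∀ m, 0 < r m) : StepWeight n where
  p := p
  c₀ := r (Fin.last n)
  c k := r k.castSucc - r k.succ
  lo := Finset.univ.inf' Finset.univ_nonempty r
  hi := Finset.univ.sup' Finset.univ_nonempty r
  p_mem := h01
  lo_pos := (Finset.lt_inf'_iff _).2 fun m _ => hr m
  lo_le t := by
    obtain ⟨m, hm⟩ := stepFun_mem_range r hp.monotone t
    rw [← hm]
    exact Finset.inf'_le _ (Finset.mem_univ m)
  le_hi t := by
    obtain ⟨m, hm⟩ := stepFun_mem_range r hp.monotone t
    rw [← hm]
    exact Finset.le_sup' _ (Finset.mem_univ m)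

theorem StepWeight.evalAt_reweight_ofValues {p : Fin n → I} (hp : StrictMono p)
    (h01 : ∀ k, p k ∈ Ioo (0 : I) 1) (hr : ∀ m, 0 < r m) (g : G0) :
    G0.evalAt p ((StepWeight.ofValues r p hp h01 hr).reweight g) =
      normalizeLast (scaleIncr r (Fin.snoc (G0.evalAt p g) 1)) := by
  set w := StepWeight.ofValues r p hp h01 hr
  set τ : Fin (n + 1) → I := Fin.snoc p 1
  have hgrid := w.stepInt_grid τ (strictMono_snoc_one hp fun j => (h01 j).2)
    (fun k => ⟨k.castSucc, by simp [τ, w, ofValues]⟩) g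
  have h1 : (fun m => stepFun w.p w.c₀ w.c (τ m)) = r := by
    ext m
    refine Fin.lastCases ?_ (fun i => ?_) m
    · have : ∀ k, ¬ (1 : I) ≤ p k := fun k => (h01 k).2.not_ge
      simp [τ, w, ofValues, stepFun, this]
    · simpa [τ, w, ofValues] using stepFun_apply_self r hp i
  have h2 : (fun m => (g (τ m) : ℝ)) = Fin.snoc (G0.evalAt p g) 1 := by
    ext m
    refine Fin.lastCases ?_ (fun i => ?_) m
    · simp [τ, g.map_one']
    · simp [τ, G0.evalAt]
  rw [h1, h2] at hgrid
  ext j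
  rw [normalizeLast, ← hgrid]
  simp [τ, G0.evalAt, StepWeight.reweight_apply, StepWeight.mass]

end StepFunOfValues

theorem isOpen_incrCone {M : ℕ} : IsOpen (incrCone M) := by
  rw [incrCone, ofPred_forall]
  exact isOpen_iInter_of_finite fun m => isOpen_lt continuous_const
    ((continuous_apply m).comp (LinearMap.continuous_of_finiteDimensional (incr M)))

theorem continuous_snoc_one {M : ℕ} :
    Continuous fun z : Fin M → ℝ => (Fin.snoc z 1 : Fin (M + 1) → ℝ) := by
  refine continuous_pi fun m => ?_
  refine Fin.lastCases ?_ (fun i => ?_) m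
  · simpa using continuous_const
  · simpa using continuous_apply i

/-- The Dirichlet process charges the open sets of the finite dimensional marginals. -/
theorem IsDirichletProcess.evalAt_preimage_pos {β : ℝ} {Q : Measure G0}
    (hQ : IsDirichletProcess β Q) (hβ : 0 < β) {M : ℕ} {τ : Fin M → I} (hτ : StrictMono τ)
    (h01 : ∀ j, τ j ∈ Ioo (0 : I) 1) {U : Set (Fin M → ℝ)} (hU : IsOpen U) {z : Fin M → ℝ}
    (hzU : z ∈ U) (hz : (Fin.snoc z 1 : Fin (M + 1) → ℝ) ∈ incrCone M) :
    0 < Q (G0.evalAt τ ⁻¹' U) := by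
  rw [← Measure.map_apply (G0.measurable_evalAt τ) hU.measurableSet, hQ.map_evalAt hτ h01,
    withDensity_apply _ hU.measurableSet,
    setLIntegral_pos_iff (measurable_dirichletDensity β _).ennreal_ofReal]
  -- On this nonempty open set the Dirichlet density is strictly positive.
  have hW : IsOpen (U ∩ (fun z : Fin M → ℝ => (Fin.snoc z 1 : Fin (M + 1) → ℝ)) ⁻¹' incrCone M) :=
    hU.inter (isOpen_incrCone.preimage continuous_snoc_one)
  refine (hW.measure_pos volume ⟨z, hzU, hz⟩).trans_le (measure_mono fun x hx => ⟨?_, hx.1⟩)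
  have hx2 : (Fin.snoc x 1 : Fin (M + 1) → ℝ) ∈ incrCone M := hx.2
  rw [Function.mem_support, Ne, ENNReal.ofReal_eq_zero, not_le, dirichletDensity_eq, coneDensity,
    if_pos hx2]
  refine mul_pos (div_pos (Real.Gamma_pos_of_pos hβ) (Finset.prod_pos fun m _ => ?_))
    (Finset.prod_pos fun m _ => Real.rpow_pos_of_pos (hx2 m) _)
  exact Real.Gamma_pos_of_pos
    (mul_pos hβ (sub_pos.2 ((strictMono_padUnit hτ h01) m.castSucc_lt_succ)))

/-! ### From closeness on grids to convergence in `𝒢₀`. -/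

namespace G0

theorem coe_gridPoint {n k : ℕ} (hk : k ≤ n) : (gridPoint n k : ℝ) = (k + 1) / (n + 1) := by
  have h0 : (0 : ℝ) ≤ ((k : ℝ) + 1) / (n + 1) := by positivity
  have h1 : ((k : ℝ) + 1) / (n + 1) ≤ 1 := by
    rw [div_le_one (by positivity)]
    exact_mod_cast Nat.succ_le_succ hk
  rw [gridPoint, projIcc_of_mem _ ⟨h0, h1⟩]

theorem gridPoint_eq_one {n k : ℕ} (hk : n ≤ k) : gridPoint n k = 1 := by
  have h1 : 1 ≤ ((k : ℝ) + 1) / (n + 1) := by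
    rw [one_le_div (by positivity)]
    exact_mod_cast Nat.succ_le_succ hk
  exact projIcc_of_right_le _ h1

theorem strictMono_gridPoint (n : ℕ) : StrictMono fun j : Fin n => gridPoint n j := by
  intro i j hij
  rw [← Subtype.coe_lt_coe, coe_gridPoint i.2.le, coe_gridPoint j.2.le]
  have : (i : ℝ) < j := by exact_mod_cast hij
  gcongr

theorem gridPoint_mem_Ioo (n : ℕ) (j : Fin n) : gridPoint n j ∈ Ioo (0 : I) 1 := by
  refine ⟨gridPoint_pos _ _, ?_⟩
  rw [← Subtype.coe_lt_coe, coe_gridPoint j.2.le, Icc.coe_one, div_lt_one (by positivity)]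
  have : (j : ℝ) < n := by exact_mod_cast j.2
  linarith

/-- Convergence on the grids of mesh `1 / (n + 1)` implies convergence in `𝒢₀`. -/
theorem tendsto_of_gridPoint {k : ℕ → G0} {g : G0} {η : ℕ → ℝ} (hη0 : ∀ n, 0 ≤ η n)
    (hη : Tendsto η atTop (𝓝 0))
    (hk : ∀ n, ∀ j : Fin n, |(k n (gridPoint n j) : ℝ) - g (gridPoint n j)| ≤ η n) :
    Tendsto k atTop (𝓝 g) := by
  have hk' : ∀ n i : ℕ, |(k n (gridPoint n i) : ℝ) - g (gridPoint n i)| ≤ η n := by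
    intro n i
    rcases lt_or_ge i n with h | h
    · exact hk n ⟨i, h⟩
    · rw [gridPoint_eq_one h, (k n).map_one', g.map_one', sub_self, abs_zero]
      exact hη0 n
  -- By monotonicity the value at `t` is squeezed between the values at the neighbouring grid
  -- points, and both bounds converge where `g` is continuous.
  have hpt : ∀ t : I, 0 < t → ContinuousAt g.toFun t →
      Tendsto (fun n => (k n t : ℝ)) atTop (𝓝 (g t)) := by
    intro t ht hgt
    have ht' : (0 : ℝ) < t := ht
    have hgt' : ContinuousAt (fun s => (g s : ℝ)) t :=
      continuous_subtype_val.continuousAt.comp hgt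
    -- The last grid point not beyond `t`; the index is lowered by one because `gridPoint n k` is
    -- `(k + 1) / (n + 1)`, which is legitimate once the floor is at least `1`.
    set L : ℕ → I := fun n => gridPoint n (⌊((n : ℝ) + 1) * t⌋₊ - 1)
    have hev : ∀ᶠ n : ℕ in atTop, 1 ≤ ⌊((n : ℝ) + 1) * t⌋₊ := by
      have h : Tendsto (fun n : ℕ => ((n : ℝ) + 1) * t) atTop atTop :=
        (tendsto_atTop_add_const_right _ _ tendsto_natCast_atTop_atTop).atTop_mul_const ht'
      filter_upwards [h.eventually_ge_atTop 1] with n hn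
      exact Nat.le_floor (by simpa using hn)
    have hLe : ∀ᶠ n : ℕ in atTop, (L n : ℝ) = ⌊((n : ℝ) + 1) * t⌋₊ / ((n : ℝ) + 1) := by
      filter_upwards [hev] with n hn
      have h1 : (⌊((n : ℝ) + 1) * t⌋₊ : ℝ) ≤ n + 1 :=
        (Nat.floor_le (by positivity)).trans (mul_le_of_le_one_right (by positivity) t.2.2)
      have h2 : ⌊((n : ℝ) + 1) * t⌋₊ ≤ n + 1 := by exact_mod_cast h1
      simp only [L]
      rw [coe_gridPoint (by omega), Nat.cast_sub hn]
      simp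
    have hLle : ∀ᶠ n : ℕ in atTop, L n ≤ t := by
      filter_upwards [hLe] with n hn
      rw [← Subtype.coe_le_coe, hn, div_le_iff₀ (by positivity), mul_comm]
      exact Nat.floor_le (by positivity)
    have hLt : Tendsto L atTop (𝓝 t) := by
      rw [tendsto_subtype_rng]
      have h := tendsto_one_div_add_atTop_nhds_zero_nat (𝕜 := ℝ)
      refine tendsto_of_tendsto_of_tendsto_of_le_of_le'
        (g := fun n : ℕ => (t : ℝ) - 1 / ((n : ℝ) + 1)) (h := fun _ => (t : ℝ))
        (by simpa using h.const_sub (t : ℝ)) tendsto_const_nhds ?_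
        (hLle.mono fun n hn => hn)
      filter_upwards [hLe] with n hn
      rw [hn, sub_le_iff_le_add, ← add_div, le_div_iff₀ (by positivity), mul_comm]
      exact (Nat.lt_floor_add_one _).le
    have h1 : Tendsto (fun n => (g (L n) : ℝ) - η n) atTop (𝓝 (g t)) := by
      simpa using (hgt'.tendsto.comp hLt).sub hη
    have h2 : Tendsto (fun n => (g (gridRight n t) : ℝ) + η n) atTop (𝓝 (g t)) := by
      simpa using (tendsto_apply_gridRight g t).add hη
    refine tendsto_of_tendsto_of_tendsto_of_le_of_le' h1 h2 ?_ (Eventually.of_forall fun n => ?_)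
    · filter_upwards [hLle] with n hn
      have h3 : (k n (L n) : ℝ) ≤ k n t := (k n).mono' hn
      linarith [(abs_sub_le_iff.1 (hk' n (⌊((n : ℝ) + 1) * t⌋₊ - 1))).2]
    · have h3 : (k n t : ℝ) ≤ k n (gridRight n t) := (k n).mono' (le_gridRight n t)
      have h4 : |(k n (gridRight n t) : ℝ) - g (gridRight n t)| ≤ η n := hk' n _
      linarith [(abs_sub_le_iff.1 h4).1]
  -- A monotone map has countably many discontinuities, a null set.
  have hae : ∀ᵐ t : I, Tendsto (fun n => ((k n t : ℝ) - g t) ^ 2) atTop (𝓝 0) := by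
    have h1 : ∀ᵐ t : I, ContinuousAt g.toFun t := by
      rw [ae_iff]
      exact g.mono'.countable_not_continuousAt.measure_zero _
    have h2 : ∀ᵐ t : I, t ≠ 0 := by simp [ae_iff, measure_singleton]
    filter_upwards [h1, h2] with t ht1 ht2
    simpa using ((hpt t (lt_of_le_of_ne nonneg' ht2.symm) ht1).sub_const (g t : ℝ)).pow 2
  rw [tendsto_iff_dist_tendsto_zero]
  simp only [dist_eq]
  have h := tendsto_integral_of_dominated_convergence (fun _ => (1 : ℝ))
    (fun n => (((k n).measurable_coe.sub g.measurable_coe).pow_const 2).aestronglyMeasurable)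
    (integrable_const 1) (fun n => Eventually.of_forall fun t => by
      simpa using g.abs_sub_le_one (k n) t) hae
  have h' := (Real.continuous_sqrt.tendsto _).comp h
  rw [integral_zero, Real.sqrt_zero] at h'
  exact h'

end G0

/-! ### Transport between neighbourhoods of two points, and conclusion. -/

theorem snoc_one_interp {n : ℕ} (τ : Fin n → I) (ε : ℝ) (g : G0) :
    (Fin.snoc (fun j => (1 - ε) * (g (τ j) : ℝ) + ε * τ j) 1 : Fin (n + 1) → ℝ) =
      fun m => (1 - ε) * (g ((Fin.snoc τ 1 : Fin (n + 1) → I) m) : ℝ) +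
        ε * ((Fin.snoc τ 1 : Fin (n + 1) → I) m : ℝ) := by
  ext m
  refine Fin.lastCases ?_ (fun i => ?_) m
  · simp [g.map_one']
  · simp

/-- Mixing in a little of the identity makes the grid values strictly increasing, so that increments
can be divided. -/
theorem snoc_one_interp_mem_incrCone {n : ℕ} {τ : Fin n → I} (hτ : StrictMono τ)
    (h01 : ∀ j, τ j ∈ Ioo (0 : I) 1) {ε : ℝ} (hε0 : 0 < ε) (hε1 : ε ≤ 1) (g : G0) :
    (Fin.snoc (fun j => (1 - ε) * (g (τ j) : ℝ) + ε * τ j) 1 : Fin (n + 1) → ℝ) ∈ incrCone n := by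
  have hs := strictMono_padUnit hτ h01
  rw [padUnit, strictMono_cons_iff] at hs
  have hcoe : (Fin.snoc (fun j => (τ j : ℝ)) 1 : Fin (n + 1) → ℝ) =
      fun m => ((Fin.snoc τ 1 : Fin (n + 1) → I) m : ℝ) := by
    ext m
    refine Fin.lastCases ?_ (fun i => ?_) m <;> simp
  rw [hcoe] at hs
  rw [snoc_one_interp]
  have h1ε : 0 ≤ 1 - ε := sub_nonneg.2 hε1
  intro m
  have hm := hs m
  revert hm
  refine Fin.cases (fun hm => ?_) (fun i hm => ?_) m
  · rw [incr_zero] at hm ⊢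
    exact add_pos_of_nonneg_of_pos (mul_nonneg h1ε (g _).2.1) (mul_pos hε0 hm)
  · rw [incr_succ] at hm ⊢
    have h2 : (g ((Fin.snoc τ 1 : Fin (n + 1) → I) i.castSucc) : ℝ) ≤
        g ((Fin.snoc τ 1 : Fin (n + 1) → I) i.succ) := g.mono' (Subtype.coe_le_coe.1 (by linarith))
    nlinarith [mul_nonneg h1ε (sub_nonneg.2 h2), mul_pos hε0 hm]

/-- Near any pair of points of `𝒢₀` there is one that satisfies the Lipschitz bound. -/
theorem IsDirichletProcess.exists_pair {β : ℝ} {Q : Measure G0} (hQ : IsDirichletProcess β Q)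
    (hβ : 0 < β) {u : G0 → ℝ} (hu : Continuous u) {Du : G0 × I → ℝ}
    (hDu : IsClosedGradient Q u Du) (hΓ : ∀ᵐ g ∂Q, squareField Du Du g ≤ 1) (g h : G0) {n : ℕ}
    {τ : Fin n → I} (hτ : StrictMono τ) (h01 : ∀ j, τ j ∈ Ioo (0 : I) 1) {ε : ℝ} (hε0 : 0 < ε)
    (hε1 : ε ≤ 1) :
    ∃ g' h' : G0, dist (u g') (u h') ≤ dist g' h' ∧
      (∀ j, |(g' (τ j) : ℝ) - g (τ j)| ≤ 2 * ε) ∧ ∀ j, |(h' (τ j) : ℝ) - h (τ j)| ≤ 2 * ε := by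
  set x : G0 → Fin n → ℝ := fun g j => (1 - ε) * (g (τ j) : ℝ) + ε * τ j
  have hx : ∀ g, (Fin.snoc (x g) 1 : Fin (n + 1) → ℝ) ∈ incrCone n := fun g =>
    snoc_one_interp_mem_incrCone hτ h01 hε0 hε1 g
  have hxd : ∀ g j, |x g j - g (τ j)| ≤ ε := by
    intro g j
    have h1 : x g j - g (τ j) = ε * ((τ j : ℝ) - g (τ j)) := by simp only [x]; ring
    rw [h1, abs_mul, abs_of_pos hε0]
    refine mul_le_of_le_one_right hε0.le (abs_sub_le_iff.2 ⟨?_, ?_⟩)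
    · linarith [(τ j).2.2, (g (τ j)).2.1]
    · linarith [(τ j).2.1, (g (τ j)).2.2]
  -- Multiplying the increments of `x g` by these ratios gives those of `x h`.
  set r : Fin (n + 1) → ℝ := fun m => incr n (Fin.snoc (x h) 1) m / incr n (Fin.snoc (x g) 1) m
  have hr : ∀ m, 0 < r m := fun m => div_pos (hx h m) (hx g m)
  set w := StepWeight.ofValues r τ hτ h01 hr
  have hxy : scaleIncr r (Fin.snoc (x g) 1) = Fin.snoc (x h) 1 := by
    apply incr_injective
    ext m
    rw [incr_scaleIncr]
    exact div_mul_cancel₀ _ (hx g m).ne'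
  set Ψ : (Fin n → ℝ) → Fin n → ℝ := fun z => normalizeLast (scaleIncr r (Fin.snoc z 1))
  have hΨx : Ψ (x g) = x h := by
    simp only [Ψ]
    rw [hxy, normalizeLast_snoc]
  have hΨ : ContinuousAt Ψ (x g) := by
    have hL : Continuous fun z : Fin n → ℝ => scaleIncr r (Fin.snoc z 1) :=
      (LinearMap.continuous_of_finiteDimensional (scaleIncr r)).comp continuous_snoc_one
    refine continuousAt_pi.2 fun j => ((continuous_apply _).comp hL).continuousAt.div
      ((continuous_apply _).comp hL).continuousAt ?_
    rw [hxy]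
    simp
  -- Within `δ` of `x g` the image is within `ε` of `x h`. Another `ε` comes from the perturbations
  -- `x g` and `x h` themselves, hence the bound `2 * ε`.
  obtain ⟨δ, hδ, hδΨ⟩ := Metric.continuousAt_iff.1 hΨ ε hε0
  have hpos := hQ.evalAt_preimage_pos hβ hτ h01 (Metric.isOpen_ball (x := x g) (ε := min δ ε))
    (Metric.mem_ball_self (lt_min hδ hε0)) (hx g)
  obtain ⟨k, hk, hku⟩ := ((frequently_ae_mem_iff.2 hpos.ne').and_eventually
    (hQ.ae_enorm_sub_le w hβ hu hDu hΓ)).exists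
  have hk' : dist (G0.evalAt τ k) (x g) < min δ ε := hk
  refine ⟨k, w.reweight k, ?_, fun j => ?_, fun j => ?_⟩
  · rw [← edist_eq_enorm_sub, edist_dist, edist_dist] at hku
    rw [dist_comm (u k), dist_comm k]
    exact (ENNReal.ofReal_le_ofReal_iff dist_nonneg).1 hku
  · have h1 := (dist_le_pi_dist (G0.evalAt τ k) (x g) j).trans (hk'.le.trans (min_le_right _ _))
    have h2 := abs_sub_le (k (τ j) : ℝ) (x g j) (g (τ j))
    rw [Real.dist_eq] at h1
    have h3 : |(k (τ j) : ℝ) - x g j| ≤ ε := h1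
    linarith [hxd g j]
  · have h0 := hδΨ (hk'.trans_le (min_le_left _ _))
    rw [hΨx] at h0
    have h1 := (dist_le_pi_dist (Ψ (G0.evalAt τ k)) (x h) j).trans h0.le
    have h2 := abs_sub_le (w.reweight k (τ j) : ℝ) (x h j) (h (τ j))
    have h4 : Ψ (G0.evalAt τ k) j = w.reweight k (τ j) :=
      (congrFun (StepWeight.evalAt_reweight_ofValues r hτ h01 hr k) j).symm
    rw [Real.dist_eq, h4] at h1
    linarith [hxd h j]

end

theorem mainTheorem9 (β : ℝ) (hβ : 0 < β) (Q : Measure G0) (hQ : IsDirichletProcess β Q)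
    (u : G0 → ℝ) (hu : Continuous u)
    (Du : G0 × I → ℝ) (hDu : IsClosedGradient Q u Du)
    (hΓ : ∀ᵐ g ∂Q, squareField Du Du g ≤ 1) (g h : G0) :
    |u g - u h| ≤ Real.sqrt (∫ t : I, ((g t : ℝ) - h t) ^ 2) := by
  rw [← G0.dist_eq, ← Real.dist_eq]
  have hε0 : ∀ n : ℕ, (0 : ℝ) < 1 / (n + 1) := fun n => by positivity
  have hε1 : ∀ n : ℕ, (1 : ℝ) / (n + 1) ≤ 1 := fun n => by
    rw [div_le_one (by positivity)]
    linarith [(Nat.cast_nonneg n : (0 : ℝ) ≤ n)]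
  -- The perturbation size and the grid mesh are both `1 / (n + 1)`.
  choose g' h' hd hg hh using fun n : ℕ => hQ.exists_pair hβ hu hDu hΓ g h
    (G0.strictMono_gridPoint n) (G0.gridPoint_mem_Ioo n) (hε0 n) (hε1 n)
  have hlim : Tendsto (fun n : ℕ => 2 * (1 / ((n : ℝ) + 1))) atTop (𝓝 0) := by
    simpa using (tendsto_one_div_add_atTop_nhds_zero_nat (𝕜 := ℝ)).const_mul 2
  have hg' := G0.tendsto_of_gridPoint (fun n => by positivity) hlim hg
  have hh' := G0.tendsto_of_gridPoint (fun n => by positivity) hlim hh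
  exact le_of_tendsto_of_tendsto' (((hu.tendsto g).comp hg').dist ((hu.tendsto h).comp hh'))
    (hg'.dist hh') hd
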